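/- All systems are finite-dimensional and $\log$ is to base two. \textbf{Definitions.} A channel $\mathcal N_{A'\to B}$ is \emph{teleportation-simulable with associated state} $\omega_{AB}$, where $\mathcal H_A\simeq\mathcal H_{A'}$, if there are a POVM $\{M^x\}_x$ on $A'A$ and channels $\mathcal D^x_{B\to B}$ such that $\mathcal N(\rho_{A'})=\sum_x\mathcal D^x\big(\operatorname{Tr}_{A'A}\{(M^x_{A'A}\otimes I_B)(\rho_{A'}\otimes\omega_{AB})\}\big)$ for every state $\rho_{A'}$. The relative entropy of entanglement is $E_R(A;B)_\omega=\inf_{\sigma}D(\omega_{AB}\Vert\sigma_{AB})$, where $\sigma$ ranges over the separable states (convex combinations of pure product states), and $D(\rho\Vert\sigma)=\operatorname{Tr}\{\rho(\log\rho-\log\sigma)\}$ if $\operatorname{supp}\rho\subseteq\operatorname{supp}\sigma$ and $+\infty$ otherwise. An LOCC channel is a finite composition of maps $\sum_x\mathcal E^x\otimes\mathcal F^x$ in which one party's maps are completely positive and sum to a channel (an instrument, whose outcome $x$ is announced) and the other party's maps are channels. An LOCC-assisted protocol with $n$ uses of $\mathcal N$ starts with Alice and Bob uncorrelated and applies, before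 the first use of $\mathcal N$, between any two uses and after the last one, an LOCC channel; local registers have arbitrary size. A bipartite private state with $K$ key values is a state $U(\Phi_{K_AK_B}\otimes\theta_{S_AS_B})U^\dagger$, where $\Phi$ is the maximally entangled state of Schmidt rank $K$, $\theta$ is a state, and $U=\sum_{i,j}|i\rangle\langle i|_{K_A}\otimes|j\rangle\langle j|_{K_B}\otimes U^{ij}_{S_AS_B}$ with each $U^{ij}$ unitary. A triple $(n,P,\varepsilon)$ with $\varepsilon\in[0,1]$ is \emph{achievable} for $\mathcal N$ if some LOCC-assisted protocol with $n$ uses of $\mathcal N$ outputs a state $\rho$ of $K_AS_A:K_BS_B$ with $F(\rho,\gamma)\ge 1-\varepsilon$ for some bipartite private state $\gamma$ with $K$ key values, where $\frac1n\log K\ge P$; here $F(\rho,\gamma)=\Vert\sqrt\rho\sqrt\gamma\Vert_1^2$. A number $r$ is a \emph{strong converse rate for two-way assisted private communication} over $\mathcal N$ if for every sequence of achievable triples $(n,P_n,\varepsilon_n)$, $n\ge1$, $\liminf_n P_n>r$ implies $\lim_n\varepsilon_n=1$; the infimum of these rates is $P^\dagger_{\leftrightarrow}(\mathcal N)$. \textbf{Theorem.}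 Let $\mathcal N$ be a quantum channel that is teleportation-simulable with associated state $\omega_{AB}$. Then $E_R(A;B)_\omega$ is a strong converse rate for two-way assisted private communication over $\mathcal N$; in particular $$P^\dagger_{\leftrightarrow}(\mathcal N)\le E_R(A;B)_\omega .$$ Moreover, for every real $R>E_R(A;B)_\omega$ there is a constant $c>0$ such that $1-\varepsilon\le 2^{-cn}$ for every $n\ge1$ and every $\varepsilon$ for which $(n,R,\varepsilon)$ is achievable. -/

import Mathlib

open scoped Kronecker ComplexOrder
open Filter Topology

noncomputable section

namespace QPriv

/-- Operators on the finite-dimensional Hilbert space `ℂ^a` with standard basis labelled by `a`.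
The tensor product of `ℂ^a` and `ℂ^b` is `ℂ^(a × b)`. -/
abbrev Op (a : Type) : Type := Matrix a a ℂ

/-! ### States and channels -/

/-- Density operators: positive semi-definite with trace one. -/
def IsState {a : Type} [Fintype a] (ρ : Op a) : Prop :=
  ρ.PosSemidef ∧ ρ.trace = 1

/-- The tensor product `N ⊗ M` of two linear maps on operators, i.e. the linear map with
`(N ⊗ M) (X ⊗ Y) = N X ⊗ M Y`. -/
def tensorMap {a b c d : Type} (N : Op a →ₗ[ℂ] Op c) (M : Op b →ₗ[ℂ] Op d) :
    Op (a × b) →ₗ[ℂ] Op (c × d) where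
  toFun X := Matrix.of fun p q =>
    N (Matrix.of fun k k' => M (Matrix.of fun l l' => X (k, l) (k', l')) p.2 q.2) p.1 q.1
  map_add' X Y := by
    ext p q
    have h : ∀ k k', (Matrix.of fun l l' => (X + Y) (k, l) (k', l')) =
        (Matrix.of fun l l' => X (k, l) (k', l')) + Matrix.of fun l l' => Y (k, l) (k', l') :=
      fun k k' => by ext; rfl
    have h2 : (Matrix.of fun k k' => M (Matrix.of fun l l' => (X + Y) (k, l) (k', l')) p.2 q.2) =
        (Matrix.of fun k k' => M (Matrix.of fun l l' => X (k, l) (k', l')) p.2 q.2) +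
        Matrix.of fun k k' => M (Matrix.of fun l l' => Y (k, l) (k', l')) p.2 q.2 := by
      ext k k'
      rw [Matrix.of_apply, h, map_add]
      rfl
    rw [Matrix.add_apply, Matrix.of_apply, h2, map_add]
    rfl
  map_smul' r X := by
    ext p q
    have h : ∀ k k', (Matrix.of fun l l' => (r • X) (k, l) (k', l')) =
        r • (Matrix.of fun l l' => X (k, l) (k', l')) :=
      fun k k' => by ext; rfl
    have h2 : (Matrix.of fun k k' => M (Matrix.of fun l l' => (r • X) (k, l) (k', l')) p.2 q.2) =
        r • Matrix.of fun k k' => M (Matrix.of fun l l' => X (k, l) (k', l')) p.2 q.2 := by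
      ext k k'
      rw [Matrix.of_apply, h, map_smul]
      rfl
    rw [RingHom.id_apply, Matrix.smul_apply, Matrix.of_apply, h2, map_smul]
    rfl

/-- Complete positivity: `id_R ⊗ N` is positive for a reference system `R` of every dimension. -/
def IsCP {a b : Type} (N : Op a →ₗ[ℂ] Op b) : Prop :=
  ∀ (r : ℕ) (X : Op (Fin r × a)), X.PosSemidef →
    (tensorMap (LinearMap.id : Op (Fin r) →ₗ[ℂ] Op (Fin r)) N X).PosSemidef

/-- Trace preservation. -/
def IsTP {a b : Type} [Fintype a] [Fintype b] (N : Op a →ₗ[ℂ] Op b) : Prop :=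
  ∀ X : Op a, (N X).trace = X.trace

/-- Quantum channels: completely positive trace-preserving maps. -/
def IsChannel {a b : Type} [Fintype a] [Fintype b] (N : Op a →ₗ[ℂ] Op b) : Prop :=
  IsCP N ∧ IsTP N

/-- Partial trace over the first tensor factor. -/
def traceFst {r b : Type} [Fintype r] (X : Op (r × b)) : Op b :=
  Matrix.of fun j j' => ∑ k, X (k, j) (k, j')

/-- The trace norm `Tr √(C† C)`. -/
def traceNorm {a : Type} [Fintype a] [DecidableEq a] (C : Op a) : ℝ :=
  (cfc Real.sqrt (C.conjTranspose * C)).trace.re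

/-- The fidelity `F(ρ, σ) = ‖√ρ √σ‖₁²`. -/
def fidelity {a : Type} [Fintype a] [DecidableEq a] (ρ σ : Op a) : ℝ :=
  traceNorm (cfc Real.sqrt ρ * cfc Real.sqrt σ) ^ 2

/-! ### Separable states and the relative entropy of entanglement -/

/-- The separable states of a bipartite system: the convex hull of the pure product states. -/
def separableStates (a b : Type) [Fintype a] [Fintype b] : Set (Op (a × b)) :=
  convexHull ℝ {σ | ∃ (φ : a → ℂ) (χ : b → ℂ), star φ ⬝ᵥ φ = 1 ∧ star χ ⬝ᵥ χ = 1 ∧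
    σ = Matrix.vecMulVec φ (star φ) ⊗ₖ Matrix.vecMulVec χ (star χ)}

open Classical in
/-- The quantum relative entropy (base two): `Tr ρ (log ρ - log σ)` if `ker σ ⊆ ker ρ`
(equivalently `supp ρ ⊆ supp σ`), and `+∞` otherwise. Logarithms are taken on the support
(`Real.logb 2 0 = 0`). -/
def relEntropy {a : Type} [Fintype a] [DecidableEq a] (ρ σ : Op a) : EReal :=
  if ∀ v : a → ℂ, σ.mulVec v = 0 → ρ.mulVec v = 0 then
    (((ρ * (cfc (Real.logb 2) ρ - cfc (Real.logb 2) σ)).trace.re : ℝ) : EReal)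
  else ⊤

/-- The relative entropy of entanglement `E_R(A;B)_ρ`. -/
def relEntEntanglement {a b : Type} [Fintype a] [Fintype b] [DecidableEq a] [DecidableEq b]
    (ρ : Op (a × b)) : EReal :=
  ⨅ σ ∈ separableStates a b, relEntropy ρ σ

/-! ### Teleportation simulation -/

/-- The output of a general teleportation protocol on the input state `ρ` of `A'` and the resource
state `ω` of `AB`: Alice measures `A'A` with the POVM `M`, sends the outcome `x` to Bob, and Bob
applies the correction channel `D x` to `B`. -/
def teleport {A A' B : Type} [Fintype A] [Fintype A'] [Fintype B] [DecidableEq B] {m : ℕ}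
    (M : Fin m → Op (A' × A)) (D : Fin m → Op B →ₗ[ℂ] Op B) (ρ : Op A') (ω : Op (A × B)) : Op B :=
  ∑ x, D x (traceFst ((M x ⊗ₖ (1 : Op B)) *
    (ρ ⊗ₖ ω).submatrix (Equiv.prodAssoc A' A B) (Equiv.prodAssoc A' A B)))

/-- `N : A' → B` is teleportation-simulable with associated state `ω` of `AB`, where `A ≃ A'`. -/
def TeleportationSimulable {A A' B : Type} [Fintype A] [Fintype A'] [Fintype B]
    [DecidableEq A] [DecidableEq A'] [DecidableEq B]
    (N : Op A' →ₗ[ℂ] Op B) (ω : Op (A × B)) : Prop :=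
  IsState ω ∧ Fintype.card A = Fintype.card A' ∧
  ∃ (m : ℕ) (M : Fin m → Op (A' × A)) (D : Fin m → Op B →ₗ[ℂ] Op B),
    (∀ x, (M x).PosSemidef) ∧ ∑ x, M x = 1 ∧ (∀ x, IsChannel (D x)) ∧
    ∀ ρ : Op A', IsState ρ → N ρ = teleport M D ρ ω

/-! ### LOCC channels -/

/-- Alice performs an instrument `E` and Bob a channel `F x` conditioned on its outcome `x`. -/
def IsAliceToBob {a b a' b' : Type} [Fintype a] [Fintype b] [Fintype a'] [Fintype b']
    (Λ : Op (a × b) →ₗ[ℂ] Op (a' × b')) : Prop :=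
  ∃ (m : ℕ) (E : Fin m → Op a →ₗ[ℂ] Op a') (F : Fin m → Op b →ₗ[ℂ] Op b'),
    (∀ x, IsCP (E x)) ∧ IsChannel (∑ x, E x) ∧ (∀ x, IsChannel (F x)) ∧
    Λ = ∑ x, tensorMap (E x) (F x)

/-- Bob performs an instrument `F` and Alice a channel `E x` conditioned on its outcome `x`. -/
def IsBobToAlice {a b a' b' : Type} [Fintype a] [Fintype b] [Fintype a'] [Fintype b']
    (Λ : Op (a × b) →ₗ[ℂ] Op (a' × b')) : Prop :=
  ∃ (m : ℕ) (E : Fin m → Op a →ₗ[ℂ] Op a') (F : Fin m → Op b →ₗ[ℂ] Op b'),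
    (∀ x, IsChannel (E x)) ∧ (∀ x, IsCP (F x)) ∧ IsChannel (∑ x, F x) ∧
    Λ = ∑ x, tensorMap (E x) (F x)

/-- LOCC channels: finite compositions of one-way steps in either direction. -/
inductive IsLOCC : {a b a' b' : Type} → [Fintype a] → [Fintype b] → [Fintype a'] → [Fintype b'] →
    (Op (a × b) →ₗ[ℂ] Op (a' × b')) → Prop
  | aliceToBob {a b a' b' : Type} [Fintype a] [Fintype b] [Fintype a'] [Fintype b']
      (Λ : Op (a × b) →ₗ[ℂ] Op (a' × b')) (h : IsAliceToBob Λ) : IsLOCC Λ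
  | bobToAlice {a b a' b' : Type} [Fintype a] [Fintype b] [Fintype a'] [Fintype b']
      (Λ : Op (a × b) →ₗ[ℂ] Op (a' × b')) (h : IsBobToAlice Λ) : IsLOCC Λ
  | comp {a b a' b' a'' b'' : Type} [Fintype a] [Fintype b] [Fintype a'] [Fintype b']
      [Fintype a''] [Fintype b'']
      (Λ : Op (a × b) →ₗ[ℂ] Op (a' × b')) (Γ : Op (a' × b') →ₗ[ℂ] Op (a'' × b''))
      (hΛ : IsLOCC Λ) (hΓ : IsLOCC Γ) : IsLOCC (Γ ∘ₗ Λ)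

/-! ### LOCC-assisted secret-key agreement -/

/-- One use of the channel `N : A' → B`: Alice holds a register `a` and the channel input `A'`, Bob
holds a register `b`; afterwards Alice holds `a` and Bob holds the channel output `B` and `b`. -/
def useChannel {A' B : Type} (N : Op A' →ₗ[ℂ] Op B) {a b : Type} (ρ : Op ((a × A') × b)) :
    Op (a × (B × b)) :=
  tensorMap (LinearMap.id : Op a →ₗ[ℂ] Op a)
    (tensorMap N (LinearMap.id : Op b →ₗ[ℂ] Op b))
    (ρ.submatrix (Equiv.prodAssoc a A' b).symm (Equiv.prodAssoc a A' b).symm)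

/-- `ProtocolOutput N n ρ`: the bipartite state `ρ` (Alice's systems first) is the output of an
adaptive LOCC-assisted protocol with exactly `n` uses of `N`. Alice and Bob start uncorrelated,
apply an LOCC channel before the first use of `N`, between any two uses, and after the last one;
the local registers have arbitrary size. -/
inductive ProtocolOutput {A' B : Type} [Fintype A'] [Fintype B] (N : Op A' →ₗ[ℂ] Op B) :
    ℕ → {a b : Type} → [Fintype a] → [Fintype b] → Op (a × b) → Prop
  | init {a b : Type} [Fintype a] [Fintype b]
      (Λ : Op (Unit × Unit) →ₗ[ℂ] Op (a × b)) (hΛ : IsLOCC Λ) :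
      ProtocolOutput N 0 (Λ 1)
  | use {n : ℕ} {a b a' b' : Type} [Fintype a] [Fintype b] [Fintype a'] [Fintype b']
      (ρ : Op ((a × A') × b)) (hρ : ProtocolOutput N n ρ)
      (Λ : Op (a × (B × b)) →ₗ[ℂ] Op (a' × b')) (hΛ : IsLOCC Λ) :
      ProtocolOutput N (n + 1) (Λ (useChannel N ρ))

/-- The twisting unitary `∑ i j, |i⟩⟨i| ⊗ |j⟩⟨j| ⊗ V i j`, with Alice's key and shield systems
followed by Bob's key and shield systems; `V i j` acts on the two shield systems. -/
def twisting {K : ℕ} {sA sB : Type} (V : Fin K → Fin K → Op (sA × sB)) :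
    Op ((Fin K × sA) × (Fin K × sB)) :=
  Matrix.of fun p q =>
    if p.1.1 = q.1.1 ∧ p.2.1 = q.2.1 then V p.1.1 p.2.1 (p.1.2, p.2.2) (q.1.2, q.2.2) else 0

/-- `Φ ⊗ θ` with `Φ = (1/K) ∑ i j, |i⟩⟨j| ⊗ |i⟩⟨j|` the maximally entangled state of the key systems
and `θ` a state of the shield systems. -/
def keyTensorShield {K : ℕ} {sA sB : Type} (θ : Op (sA × sB)) :
    Op ((Fin K × sA) × (Fin K × sB)) :=
  Matrix.of fun p q =>
    (if p.1.1 = p.2.1 ∧ q.1.1 = q.2.1 then (1 / (K : ℂ)) else 0) * θ (p.1.2, p.2.2) (q.1.2, q.2.2)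

/-- Bipartite private states with `K` key values (`log₂ K` bits of secret key). -/
def IsPrivateState {K : ℕ} {sA sB : Type} [Fintype sA] [Fintype sB] [DecidableEq sA]
    [DecidableEq sB] (γ : Op ((Fin K × sA) × (Fin K × sB))) : Prop :=
  ∃ (V : Fin K → Fin K → Op (sA × sB)) (θ : Op (sA × sB)),
    (∀ i j, V i j ∈ Matrix.unitaryGroup (sA × sB) ℂ) ∧ IsState θ ∧
    γ = twisting V * keyTensorShield θ * (twisting V).conjTranspose

/-- The triple `(n, P, ε)` is achievable for LOCC-assisted secret-key agreement over `N`: some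
protocol with `n` uses of `N` outputs an `ε`-approximate bipartite private state with `K` key values,
where `(1/n) log₂ K ≥ P`. -/
def Achievable {A' B : Type} [Fintype A'] [Fintype B] (N : Op A' →ₗ[ℂ] Op B)
    (n : ℕ) (P ε : ℝ) : Prop :=
  0 ≤ ε ∧ ε ≤ 1 ∧
  ∃ (K sA sB : ℕ) (ρ γ : Op ((Fin K × Fin sA) × (Fin K × Fin sB))),
    0 < K ∧ P ≤ 1 / (n : ℝ) * Real.logb 2 K ∧
    ProtocolOutput N n ρ ∧ IsPrivateState γ ∧ 1 - ε ≤ fidelity ρ γ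

/-- `r` is a strong converse rate for two-way (LOCC) assisted private communication over `N`. -/
def IsStrongConverseRate {A' B : Type} [Fintype A'] [Fintype B] (N : Op A' →ₗ[ℂ] Op B)
    (r : EReal) : Prop :=
  ∀ P ε : ℕ → ℝ, (∀ n, 1 ≤ n → Achievable N n (P n) (ε n)) →
    r < liminf (fun n => ((P n : ℝ) : EReal)) atTop → Tendsto ε atTop (𝓝 1)

/-- The two-way assisted strong converse private capacity: the infimum of all strong converse
rates. -/
def strongConversePrivateCapacity {A' B : Type} [Fintype A'] [Fintype B]
    (N : Op A' →ₗ[ℂ] Op B) : EReal :=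
  sInf {r : EReal | IsStrongConverseRate N r}

end QPriv

end

open QPriv

namespace QPriv

open Matrix

/-! ### Positive semidefinite matrices -/

/-! Fix `R` above the relative entropy of entanglement and one separable `σ` with `D(ω‖σ) < R`. The
bound compares what the protocol does to copies of `ω` with what it does to copies of `σ`.

Teleportation simulation replaces each use of the channel by a separable map that consumes a copy of
`ω`. The adaptive protocol thus becomes a single trace-preserving map `Λ` with output `Λ(ω^⊗n)`,
while `Λ(σ^⊗n)` is separable (`ProtocolOutput.exists_reduction`). The privacy test is a projection
fixing the target private state. It accepts the output with probability at least the fidelity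
(`exists_privacyTest`), and a separable state with probability at most `1/K`
(`IsSep.privacyTest_le`). Pulled back along `Λ`, it is a test `T` with `Tr Tω^⊗n ≥ 1-ε` and `Tr
Tσ^⊗n ≤ 1/K`.

The two probabilities are related by the Petz quantity `Q = Tr ω^(1+s) σ^(-s)`, `0 < s < 1`. It is
multiplicative (`IsPetzQuantity.kronecker`) and dominates `p (p/q)^s` for every test
(`IsPetzQuantity.measured_le`). Hence `(1-ε)^(1+s) K^s ≤ Q^n`. As `Q` equals `1` at `s = 0` with
logarithmic derivative `D(ω‖σ) < R`, a small `s` gives `Q < 2^(Rs)` (`exists_isPetzQuantity_lt`).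
With `K ≥ 2^(nR)`, `1-ε` decays exponentially. -/

lemma exists_conjTranspose_mul_self {ι : Type} [Fintype ι] {M : Op ι} (h : M.PosSemidef) :
    ∃ C : Op ι, M = Cᴴ * C := by
  classical
  open scoped MatrixOrder in
  obtain ⟨C, hC⟩ := CStarAlgebra.nonneg_iff_eq_star_mul_self.mp h.nonneg
  exact ⟨C, hC⟩

lemma trace_mul_re_nonneg {ι : Type} [Fintype ι] {P Q : Op ι} (hP : P.PosSemidef)
    (hQ : Q.PosSemidef) : 0 ≤ (P * Q).trace.re := by
  obtain ⟨C, rfl⟩ := exists_conjTranspose_mul_self hP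
  rw [Matrix.mul_assoc, Matrix.trace_mul_comm]
  exact (Complex.le_def.mp (hQ.mul_mul_conjTranspose_same C).trace_nonneg).1

/-- The difference is `T(1-T)T + (1-T)T(1-T)`, a sum of two congruences of positive operators. -/
lemma posSemidef_sub_sq {ι : Type} [Fintype ι] [DecidableEq ι] {T : Op ι} (hT : T.PosSemidef)
    (hT1 : (1 - T).PosSemidef) : (T - T * T).PosSemidef := by
  have h1 := hT1.conjTranspose_mul_mul_same T
  have h2 := hT.conjTranspose_mul_mul_same (1 - T)
  rw [hT.1.eq] at h1
  rw [hT1.1.eq] at h2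
  have : T - T * T = T * (1 - T) * T + (1 - T) * T * (1 - T) := by noncomm_ring
  rw [this]
  exact h1.add h2

lemma trace_diagonal_mul_mul_conjTranspose {ι κ : Type} [Fintype ι] [DecidableEq ι] [Fintype κ]
    (d : ι → ℂ) (X Y : Matrix ι κ ℂ) :
    (diagonal d * X * Yᴴ).trace = ∑ i, ∑ j, d i * (X i j * star (Y i j)) := by
  simp only [Matrix.trace, Matrix.diag_apply, Matrix.mul_apply (M := diagonal d * X),
    Matrix.diagonal_mul, Matrix.conjTranspose_apply, mul_assoc]

/-! ### Monotonicity of the Petz-Rényi quantity under two-outcome measurements -/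

/-- Maximising the left side over the complex number `x + iy`, by completing the square, gives the
right side. In the application `a + ib` and `x + iy` are entries of `U*V` and `U*TV`. -/
lemma complete_square_bound {a b x y l m t c : ℝ} (hl : 0 ≤ l) (hm : 0 ≤ m) (ht : 0 < t)
    (h0 : m = 0 → (a ^ 2 + b ^ 2) * l = 0) :
    2 * c * (l * (a * x + b * y)) - c ^ 2 * ((l + t * m) * (x ^ 2 + y ^ 2)) ≤
      (a ^ 2 + b ^ 2) * l * (l / m / (l / m + t)) := by
  rcases hl.eq_or_lt with rfl | hl
  · have : 0 ≤ c ^ 2 * ((0 + t * m) * (x ^ 2 + y ^ 2)) := by positivity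
    simp only [zero_div, zero_mul, mul_zero]
    linarith
  -- At `m = 0` the convention `l / 0 = 0` makes the right side vanish, so the support condition has
  -- to remove the cross term.
  rcases hm.eq_or_lt with rfl | hm
  · have h1 := (mul_eq_zero.mp (h0 rfl)).resolve_right hl.ne'
    have ha : a = 0 := by nlinarith [sq_nonneg a, sq_nonneg b]
    have hb : b = 0 := by nlinarith [sq_nonneg a, sq_nonneg b]
    have : 0 ≤ c ^ 2 * ((l + t * 0) * (x ^ 2 + y ^ 2)) := by positivity
    subst ha hb
    simp only [zero_mul, mul_zero, add_zero] at *
    simp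
    linarith
  have hs : 0 < l + t * m := by positivity
  have h1 : l / m / (l / m + t) = l / (l + t * m) := by field_simp
  rw [h1, ← mul_div_assoc, le_div_iff₀ hs]
  nlinarith [sq_nonneg (a * l - c * x * (l + t * m)), sq_nonneg (b * l - c * y * (l + t * m))]

section
variable {ι : Type} [Fintype ι] [DecidableEq ι]

/-- A variational proof. In the two eigenbases, `Tr Tρ` is the real part of the pairing of `W = U*V`
and `M = U*TV` with weights `l i`, and `∑ (l i + t m j)|M i j|²` is `Tr T²ρ + t Tr T²σ ≤ p + tq`.
Completing the square entrywise yields a bound for each real `c`, and the best `c` gives the claim.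
-/
lemma measured_resolvent_le {U V T : Op ι} (hV : V * Vᴴ = 1)
    (hU' : U * Uᴴ = 1) {l m : ι → ℝ} (hl : ∀ i, 0 ≤ l i) (hm : ∀ i, 0 ≤ m i)
    (h0 : ∀ i j, m j = 0 → Complex.normSq ((Uᴴ * V) i j) * l i = 0)
    (hT : T.PosSemidef) (hT1 : (1 - T).PosSemidef) {q t : ℝ} (hq : 0 < q) (ht : 0 < t)
    (hTσ : (T * (V * diagonal (fun i => (m i : ℂ)) * Vᴴ)).trace.re ≤ q) {p : ℝ} (hp : 0 < p)
    (hTρ : p = (T * (U * diagonal (fun i => (l i : ℂ)) * Uᴴ)).trace.re) :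
    p * (p / q / (p / q + t)) ≤
      ∑ i, ∑ j, Complex.normSq ((Uᴴ * V) i j) * l i * (l i / m j / (l i / m j + t)) := by
  set W := Uᴴ * V with hW
  set M := Uᴴ * T * V with hM
  have hTs : T = Tᴴ := hT.1.eq.symm
  have key : ∀ c : ℝ, 2 * c * p - c ^ 2 * (p + t * q) ≤
      ∑ i, ∑ j, Complex.normSq (W i j) * l i * (l i / m j / (l i / m j + t)) := by
    intro c
    have e1 : p = ∑ i, ∑ j, l i * ((W i j).re * (M i j).re + (W i j).im * (M i j).im) := by
      have : T * (U * diagonal (fun i => (l i : ℂ)) * Uᴴ) =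
          T * U * diagonal (fun i => (l i : ℂ)) * Uᴴ := by simp only [Matrix.mul_assoc]
      rw [hTρ, this, Matrix.trace_mul_comm]
      have : Uᴴ * (T * U * diagonal (fun i => (l i : ℂ))) =
        M * Wᴴ * diagonal (fun i => (l i : ℂ)) := by
        rw [hM, hW, conjTranspose_mul, conjTranspose_conjTranspose]
        calc _ = Uᴴ * T * 1 * U * diagonal (fun i => (l i : ℂ)) := by
              simp only [Matrix.mul_assoc, Matrix.mul_one]
          _ = _ := by rw [← hV]; simp only [Matrix.mul_assoc]
      rw [this, Matrix.trace_mul_comm, ← Matrix.mul_assoc, trace_diagonal_mul_mul_conjTranspose]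
      simp only [Complex.re_sum]
      refine Finset.sum_congr rfl fun i _ => Finset.sum_congr rfl fun j _ => ?_
      simp only [Complex.mul_re, Complex.ofReal_re, Complex.ofReal_im, Complex.star_def,
        Complex.conj_re, Complex.conj_im]
      ring
    have e2 : ∑ i, ∑ j, l i * Complex.normSq (M i j) =
        (T * T * (U * diagonal (fun i => (l i : ℂ)) * Uᴴ)).trace.re := by
      have : T * T * (U * diagonal (fun i => (l i : ℂ)) * Uᴴ) =
          T * T * U * diagonal (fun i => (l i : ℂ)) * Uᴴ := by simp only [Matrix.mul_assoc]
      rw [this, Matrix.trace_mul_comm]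
      have : Uᴴ * (T * T * U * diagonal (fun i => (l i : ℂ))) =
        M * Mᴴ * diagonal (fun i => (l i : ℂ)) := by
        rw [hM, conjTranspose_mul, conjTranspose_mul, conjTranspose_conjTranspose, ← hTs]
        calc _ = Uᴴ * T * 1 * T * U * diagonal (fun i => (l i : ℂ)) := by
              simp only [Matrix.mul_assoc, Matrix.mul_one]
          _ = _ := by rw [← hV]; simp only [Matrix.mul_assoc]
      rw [this, Matrix.trace_mul_comm, ← Matrix.mul_assoc, trace_diagonal_mul_mul_conjTranspose]
      simp only [Complex.re_sum]
      refine Finset.sum_congr rfl fun i _ => Finset.sum_congr rfl fun j _ => ?_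
      simp only [Complex.star_def, Complex.mul_conj]
      simp
    have e3 : ∑ i, ∑ j, m j * Complex.normSq (M i j) =
        (T * T * (V * diagonal (fun i => (m i : ℂ)) * Vᴴ)).trace.re := by
      have : T * T * (V * diagonal (fun i => (m i : ℂ)) * Vᴴ) =
          T * T * V * diagonal (fun i => (m i : ℂ)) * Vᴴ := by simp only [Matrix.mul_assoc]
      rw [this, Matrix.trace_mul_comm]
      have : Vᴴ * (T * T * V * diagonal (fun i => (m i : ℂ))) =
        Mᴴ * Mᴴᴴ * diagonal (fun i => (m i : ℂ)) := by
        rw [conjTranspose_conjTranspose, hM, conjTranspose_mul, conjTranspose_mul,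
          conjTranspose_conjTranspose, ← hTs]
        calc _ = Vᴴ * T * 1 * T * V * diagonal (fun i => (m i : ℂ)) := by
              simp only [Matrix.mul_assoc, Matrix.mul_one]
          _ = _ := by rw [← hU']; simp only [Matrix.mul_assoc]
      rw [this, Matrix.trace_mul_comm, ← Matrix.mul_assoc, trace_diagonal_mul_mul_conjTranspose,
        Finset.sum_comm]
      simp only [Complex.re_sum]
      refine Finset.sum_congr rfl fun i _ => Finset.sum_congr rfl fun j _ => ?_
      simp only [Complex.star_def, Complex.mul_conj]
      simp [Complex.normSq_apply]
    have hρ : (U * diagonal (fun i => (l i : ℂ)) * Uᴴ).PosSemidef :=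
      (Matrix.PosSemidef.diagonal (fun i => by simpa using hl i)).mul_mul_conjTranspose_same U
    have hσ : (V * diagonal (fun i => (m i : ℂ)) * Vᴴ).PosSemidef :=
      (Matrix.PosSemidef.diagonal (fun i => by simpa using hm i)).mul_mul_conjTranspose_same V
    -- This is where `T² ≤ T` enters, once against each state.
    have i2 := trace_mul_re_nonneg (posSemidef_sub_sq hT hT1) hρ
    have i3 := trace_mul_re_nonneg (posSemidef_sub_sq hT hT1) hσ
    rw [Matrix.sub_mul, Matrix.trace_sub, Complex.sub_re] at i2 i3
    have hsum : 2 * c * p - c ^ 2 * (∑ i, ∑ j, (l i + t * m j) * Complex.normSq (M i j)) ≤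
        ∑ i, ∑ j, Complex.normSq (W i j) * l i * (l i / m j / (l i / m j + t)) := by
      rw [e1]
      simp only [Finset.mul_sum, ← Finset.sum_sub_distrib]
      refine Finset.sum_le_sum fun i _ => Finset.sum_le_sum fun j _ => ?_
      have := complete_square_bound (a := (W i j).re) (b := (W i j).im) (x := (M i j).re)
        (y := (M i j).im) (c := c) (hl i) (hm j) ht
        (fun h => by have := h0 i j h; simpa [Complex.normSq_apply, sq] using this)
      simpa [Complex.normSq_apply, sq] using this
    have hle : ∑ i, ∑ j, (l i + t * m j) * Complex.normSq (M i j) ≤ p + t * q := by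
      have : ∑ i, ∑ j, (l i + t * m j) * Complex.normSq (M i j) =
          ∑ i, ∑ j, l i * Complex.normSq (M i j) + t * ∑ i, ∑ j, m j * Complex.normSq (M i j) := by
        simp only [Finset.mul_sum, ← Finset.sum_add_distrib]
        refine Finset.sum_congr rfl fun i _ => Finset.sum_congr rfl fun j _ => by ring
      rw [this, e2, e3]
      have : t * (T * T * (V * diagonal (fun i => (m i : ℂ)) * Vᴴ)).trace.re ≤ t * q :=
        mul_le_mul_of_nonneg_left (by linarith) ht.le
      linarith
    have := mul_le_mul_of_nonneg_left hle (sq_nonneg c)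
    linarith
  -- The maximiser of `2cp - c²(p + tq)`; the maximum is `p²/(p + tq)`.
  have h := key (p / (p + t * q))
  have hpq : 0 < p + t * q := by positivity
  convert h using 1
  field_simp
  ring

/-- `ρ` and `σ` are positive semi-definite with `supp ρ ⊆ supp σ`, and `Q = Tr ρ^(1+s) σ^(-s)`,
expressed through eigendecompositions. -/
def IsPetzQuantity (ρ σ : Op ι) (s Q : ℝ) : Prop :=
  ∃ (U V : Op ι) (l m : ι → ℝ), Uᴴ * U = 1 ∧ U * Uᴴ = 1 ∧ Vᴴ * V = 1 ∧ V * Vᴴ = 1 ∧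
    (∀ i, 0 ≤ l i) ∧ (∀ i, 0 ≤ m i) ∧
    ρ = U * diagonal (fun i => (l i : ℂ)) * Uᴴ ∧ σ = V * diagonal (fun i => (m i : ℂ)) * Vᴴ ∧
    (∀ i j, m j = 0 → Complex.normSq ((Uᴴ * V) i j) * l i = 0) ∧
    Q = ∑ i, ∑ j, Complex.normSq ((Uᴴ * V) i j) * l i * (l i / m j) ^ s

-- For `0 < s < 1`, `x^s` is a positive constant times the integral over `t > 0` of `t^(s-1)
-- x/(x+t)`. The bound therefore follows by integrating `measured_resolvent_le`.
open MeasureTheory Real in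
lemma IsPetzQuantity.measured_le {ρ σ : Op ι} {s Q : ℝ} (h : IsPetzQuantity ρ σ s Q)
    (hs : s ∈ Set.Ioo (0 : ℝ) 1) {T : Op ι}
    (hT : T.PosSemidef) (hT1 : (1 - T).PosSemidef) {q : ℝ} (hq : 0 < q)
    (hTσ : (T * σ).trace.re ≤ q) {p : ℝ} (hp : 0 < p) (hTρ : p = (T * ρ).trace.re) :
    p * (p / q) ^ s ≤ Q := by
  obtain ⟨U, V, l, m, hU, hU', hV', hV, hl, hm, rfl, rfl, h0, rfl⟩ := h
  have hx : ∀ i j, 0 ≤ l i / m j := fun i j => div_nonneg (hl i) (hm j)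
  have hpq : 0 ≤ p / q := by positivity
  set C := ∫ t in Set.Ioi 0, rpowIntegrand₀₁ s t 1
  have hC : 0 < C⁻¹ := inv_pos.mpr (integral_rpowIntegrand₀₁_one_pos hs)
  have hint : ∀ x, 0 ≤ x → IntegrableOn (rpowIntegrand₀₁ s · x) (Set.Ioi 0) :=
    fun x hx => integrableOn_rpowIntegrand₀₁_Ioi hs hx
  have hmono : ∫ t in Set.Ioi 0, p * rpowIntegrand₀₁ s t (p / q) ≤ ∫ t in Set.Ioi 0,
      ∑ i, ∑ j, Complex.normSq ((Uᴴ * V) i j) * l i * rpowIntegrand₀₁ s t (l i / m j) := by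
    refine setIntegral_mono_on ((hint _ hpq).const_mul p) ?_ measurableSet_Ioi fun t ht => ?_
    · exact integrable_finsetSum _ fun i _ => integrable_finsetSum _ fun j _ =>
        (hint _ (hx i j)).const_mul _
    · have ht' : (0 : ℝ) < t := ht
      have hform : ∀ x, 0 ≤ x → rpowIntegrand₀₁ s t x = t ^ (s - 1) * (x / (x + t)) := by
        intro x hx
        rw [rpowIntegrand₀₁_eq_pow_div hs ht'.le hx, add_comm t x, mul_div_assoc]
      rw [hform _ hpq]
      have := mul_le_mul_of_nonneg_left
        (measured_resolvent_le hV hU' hl hm h0 hT hT1 hq ht' hTσ hp hTρ)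
        (Real.rpow_nonneg ht'.le (s - 1))
      refine le_of_eq_of_le (by ring) (this.trans_eq ?_)
      rw [Finset.mul_sum]
      refine Finset.sum_congr rfl fun i _ => ?_
      rw [Finset.mul_sum]
      refine Finset.sum_congr rfl fun j _ => ?_
      rw [hform _ (hx i j)]
      ring
  rw [integral_const_mul, integral_finsetSum _ fun i _ => integrable_finsetSum _ fun j _ =>
        (hint _ (hx i j)).const_mul _] at hmono
  have : ∀ i, (∫ t in Set.Ioi 0, ∑ j, Complex.normSq ((Uᴴ * V) i j) * l i *
      rpowIntegrand₀₁ s t (l i / m j)) = ∑ j, Complex.normSq ((Uᴴ * V) i j) * l i *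
      ∫ t in Set.Ioi 0, rpowIntegrand₀₁ s t (l i / m j) := by
    intro i
    rw [integral_finsetSum _ fun j _ => (hint _ (hx i j)).const_mul _]
    simp only [integral_const_mul]
  simp only [this] at hmono
  rw [rpow_eq_const_mul_integral hs hpq]
  have h2 := mul_le_mul_of_nonneg_left hmono hC.le
  refine le_of_eq_of_le (by ring) (h2.trans_eq ?_)
  simp only [Finset.mul_sum]
  refine Finset.sum_congr rfl fun i _ => Finset.sum_congr rfl fun j _ => ?_
  rw [rpow_eq_const_mul_integral hs (hx i j)]
  ring

/-- Eigenbases and eigenvalues tensor, so overlaps and eigenvalue ratios multiply and the double sum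
factorises. -/
lemma IsPetzQuantity.kronecker {κ : Type} [Fintype κ] [DecidableEq κ] {ρ σ : Op ι} {ρ' σ' : Op κ}
    {s Q Q' : ℝ} (h : IsPetzQuantity ρ σ s Q) (h' : IsPetzQuantity ρ' σ' s Q') :
    IsPetzQuantity (ρ ⊗ₖ ρ') (σ ⊗ₖ σ') s (Q * Q') := by
  obtain ⟨U, V, l, m, hU, hU', hV', hV, hl, hm, rfl, rfl, h0, rfl⟩ := h
  obtain ⟨X, Y, a, b, hX, hX', hY', hY, ha, hb, rfl, rfl, g0, rfl⟩ := h'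
  have hk : (U ⊗ₖ X)ᴴ * (V ⊗ₖ Y) = (Uᴴ * V) ⊗ₖ (Xᴴ * Y) := by
    rw [conjTranspose_kronecker, mul_kronecker_mul]
  refine ⟨U ⊗ₖ X, V ⊗ₖ Y, fun i => l i.1 * a i.2, fun i => m i.1 * b i.2, ?_, ?_, ?_, ?_,
    fun i => mul_nonneg (hl _) (ha _), fun i => mul_nonneg (hm _) (hb _), ?_, ?_, ?_, ?_⟩
  · rw [conjTranspose_kronecker, ← mul_kronecker_mul, hU, hX, one_kronecker_one]
  · rw [conjTranspose_kronecker, ← mul_kronecker_mul, hU', hX', one_kronecker_one]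
  · rw [conjTranspose_kronecker, ← mul_kronecker_mul, hV', hY', one_kronecker_one]
  · rw [conjTranspose_kronecker, ← mul_kronecker_mul, hV, hY, one_kronecker_one]
  · simp only [mul_kronecker_mul, diagonal_kronecker_diagonal, conjTranspose_kronecker,
      Complex.ofReal_mul]
  · simp only [mul_kronecker_mul, diagonal_kronecker_diagonal, conjTranspose_kronecker,
      Complex.ofReal_mul]
  · rintro ⟨i, i'⟩ ⟨j, j'⟩ h
    rw [hk, kronecker_apply, Complex.normSq_mul, mul_mul_mul_comm]
    rcases mul_eq_zero.mp h with h | h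
    · rw [h0 i j h, zero_mul]
    · rw [g0 i' j' h, mul_zero]
  · simp only [hk, Fintype.sum_prod_type, kronecker_apply, Complex.normSq_mul, Finset.sum_mul_sum]
    refine Finset.sum_congr rfl fun i _ => ?_
    refine Finset.sum_congr rfl fun i' _ => ?_
    refine Finset.sum_congr rfl fun j _ => ?_
    refine Finset.sum_congr rfl fun j' _ => ?_
    rw [mul_div_mul_comm, Real.mul_rpow (div_nonneg (hl _) (hm _)) (div_nonneg (ha _) (hb _))]
    ring

lemma isPetzQuantity_one (s : ℝ) : IsPetzQuantity (1 : Op Unit) (1 : Op Unit) s 1 :=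
  ⟨1, 1, fun _ => 1, fun _ => 1, by simp, by simp, by simp, by simp, by simp, by simp, by simp,
    by simp, by simp, by simp⟩

end

section
variable {ι : Type} [Fintype ι] [DecidableEq ι]

/-! ### The derivative of the Petz-Rényi quantity -/

lemma trace_mul_of_diagonalization (U V : Op ι) (a b : ι → ℝ) :
    (U * diagonal (fun i => (a i : ℂ)) * Uᴴ * (V * diagonal (fun i => (b i : ℂ)) * Vᴴ)).trace.re =
      ∑ i, ∑ j, Complex.normSq ((Uᴴ * V) i j) * a i * b j := by
  have : (U * diagonal (fun i => (a i : ℂ)) * Uᴴ * (V * diagonal (fun i => (b i : ℂ)) * Vᴴ)).trace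
      = (diagonal (fun i => (a i : ℂ)) * (Uᴴ * V * diagonal (fun i => (b i : ℂ))) *
        (Uᴴ * V)ᴴ).trace := by
    rw [conjTranspose_mul, conjTranspose_conjTranspose]
    simp only [Matrix.mul_assoc]
    rw [Matrix.trace_mul_comm]
    simp only [Matrix.mul_assoc]
  rw [this, trace_diagonal_mul_mul_conjTranspose]
  simp only [Complex.re_sum, Matrix.mul_diagonal]
  refine Finset.sum_congr rfl fun i _ => Finset.sum_congr rfl fun j _ => ?_
  have : (a i : ℂ) * ((Uᴴ * V) i j * (b j : ℂ) * star ((Uᴴ * V) i j)) =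
      ((Complex.normSq ((Uᴴ * V) i j) * a i * b j : ℝ) : ℂ) := by
    push_cast
    rw [← Complex.mul_conj]
    simp only [Complex.star_def]
    ring
  rw [this, Complex.ofReal_re]

lemma cfc_eq_diagonalization {ρ : Op ι} (h : ρ.IsHermitian) (f : ℝ → ℝ) :
    cfc f ρ = (h.eigenvectorUnitary : Op ι) * diagonal (fun i => (f (h.eigenvalues i) : ℂ)) *
      (h.eigenvectorUnitary : Op ι)ᴴ := by
  rw [h.cfc_eq]; rfl

lemma eq_diagonalization {ρ : Op ι} (h : ρ.IsHermitian) :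
    ρ = (h.eigenvectorUnitary : Op ι) * diagonal (fun i => (h.eigenvalues i : ℂ)) *
      (h.eigenvectorUnitary : Op ι)ᴴ :=
  h.spectral_theorem

/-- Both sides equal `1` at `s = 0`, and the hypothesis on `R` says that the left side has the
smaller derivative there. -/
lemma exists_sum_mul_rpow_lt {κ : Type} [Fintype κ] (c x : κ → ℝ)
    (hx : ∀ k, x k = 0 → c k = 0) (hx0 : ∀ k, 0 ≤ x k) (h1 : ∑ k, c k = 1) {R : ℝ}
    (hR : ∑ k, c k * Real.logb 2 (x k) < R) :
    ∃ s ∈ Set.Ioo (0 : ℝ) 1, ∑ k, c k * x k ^ s < (2 : ℝ) ^ (R * s) := by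
  have hd : ∀ k, HasDerivAt (fun s : ℝ => c k * x k ^ s) (c k * Real.log (x k)) 0 := by
    intro k
    -- The function `0^s` jumps at `s = 0`, but its coefficient is zero.
    rcases (hx0 k).eq_or_lt with h | h
    · simp only [hx k h.symm, zero_mul]
      exact hasDerivAt_const _ _
    · have := ((hasDerivAt_id (0 : ℝ)).const_rpow h).const_mul (c k)
      simpa using this
  have hd2 : HasDerivAt (fun s : ℝ => (2 : ℝ) ^ (R * s)) (Real.log 2 * R) 0 := by
    have := ((hasDerivAt_id (0 : ℝ)).const_mul R).const_rpow (a := (2 : ℝ)) two_pos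
    simpa using this
  have hf : HasDerivAt (fun s : ℝ => ∑ k, c k * x k ^ s - (2 : ℝ) ^ (R * s))
      (∑ k, c k * Real.log (x k) - Real.log 2 * R) 0 :=
    (HasDerivAt.fun_sum fun k _ => hd k).sub hd2
  have hneg : ∑ k, c k * Real.log (x k) - Real.log 2 * R < 0 := by
    have hl : (0 : ℝ) < Real.log 2 := Real.log_pos one_lt_two
    have := mul_lt_mul_of_pos_left hR hl
    have e : Real.log 2 * ∑ k, c k * Real.logb 2 (x k) = ∑ k, c k * Real.log (x k) := by
      rw [Finset.mul_sum]
      refine Finset.sum_congr rfl fun k _ => ?_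
      rw [Real.logb]
      field_simp
    linarith
  have hs := hf.tendsto_slope.mono_left (nhdsWithin_mono 0
    (fun y (hy : y ∈ Set.Ioi (0 : ℝ)) => (ne_of_gt hy : y ≠ 0)))
  have hev := (hs.eventually (gt_mem_nhds hneg)).and
    (Ioo_mem_nhdsGT (zero_lt_one : (0 : ℝ) < 1))
  obtain ⟨s, hs1, hs2⟩ := hev.exists
  refine ⟨s, hs2, ?_⟩
  rw [slope_def_field, sub_zero] at hs1
  have := (div_neg_iff.mp hs1).resolve_left (fun h => absurd h.2 (not_lt.mpr hs2.1.le))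
  simp [h1] at this
  linarith [this.1]

/-- The weights `|W i j|² l i` form a probability distribution. The relative entropy is its mean of
`log (l i / m j)` and `Q` its mean of `(l i / m j)^s`, which reduces the claim to the scalar lemma.
-/
lemma exists_isPetzQuantity_lt {ω σ : Op ι} (hω : IsState ω) (hσ : σ.PosSemidef) {R : ℝ}
    (hR : relEntropy ω σ < R) :
    ∃ s ∈ Set.Ioo (0 : ℝ) 1, ∃ Q, IsPetzQuantity ω σ s Q ∧ Q < (2 : ℝ) ^ (R * s) := by
  have hωh := hω.1.1
  have hσh := hσ.1
  unfold relEntropy at hR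
  split_ifs at hR with hker
  swap
  · exact absurd hR not_top_lt
  rw [EReal.coe_lt_coe_iff] at hR
  set U : Op ι := hωh.eigenvectorUnitary.1
  set V : Op ι := hσh.eigenvectorUnitary.1
  set l := hωh.eigenvalues
  set m := hσh.eigenvalues
  have hU : Uᴴ * U = 1 := Unitary.coe_star_mul_self hωh.eigenvectorUnitary
  have hU' : U * Uᴴ = 1 := Unitary.coe_mul_star_self hωh.eigenvectorUnitary
  have hV : Vᴴ * V = 1 := Unitary.coe_star_mul_self hσh.eigenvectorUnitary
  have hV' : V * Vᴴ = 1 := Unitary.coe_mul_star_self hσh.eigenvectorUnitary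
  have eω : ω = U * diagonal (fun i => (l i : ℂ)) * Uᴴ := eq_diagonalization hωh
  have eσ : σ = V * diagonal (fun i => (m i : ℂ)) * Vᴴ := eq_diagonalization hσh
  have lω : cfc (Real.logb 2) ω = U * diagonal (fun i => (Real.logb 2 (l i) : ℂ)) * Uᴴ :=
    cfc_eq_diagonalization hωh _
  have lσ : cfc (Real.logb 2) σ = V * diagonal (fun i => (Real.logb 2 (m i) : ℂ)) * Vᴴ :=
    cfc_eq_diagonalization hσh _
  have hl : ∀ i, 0 ≤ l i := hω.1.eigenvalues_nonneg
  have hm : ∀ i, 0 ≤ m i := hσ.eigenvalues_nonneg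
  -- Column `j` of `V` lies in `ker σ`, hence in `ker ρ` for `ρ = ω`; entry `i` of `U*ωV` in that
  -- column is `l i * W i j`.
  have h0 : ∀ i j, m j = 0 → Complex.normSq ((Uᴴ * V) i j) * l i = 0 := by
    intro i j hj
    have h1 : σ.mulVec (V.mulVec (Pi.single j 1)) = 0 := by
      rw [Matrix.mulVec_mulVec, eσ, Matrix.mul_assoc, hV, Matrix.mul_one, ← Matrix.mulVec_mulVec,
        Matrix.diagonal_mulVec_single, hj]
      simp
    have h2 := hker _ h1
    have h3 : ((Uᴴ * ω) * V).mulVec (Pi.single j 1) = 0 := by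
      rw [Matrix.mul_assoc, ← Matrix.mulVec_mulVec, ← Matrix.mulVec_mulVec, h2, mulVec_zero]
    rw [eω, ← Matrix.mul_assoc, ← Matrix.mul_assoc, hU, Matrix.one_mul, Matrix.mul_assoc] at h3
    have h4 := congrFun h3 i
    rw [Matrix.mulVec_single_one, Matrix.col_apply, Matrix.diagonal_mul] at h4
    rcases mul_eq_zero.mp h4 with h | h
    · rw [Complex.ofReal_eq_zero.mp h, mul_zero]
    · rw [h, map_zero, zero_mul]
  have hsum : ∀ a : ι → ℝ, (U * diagonal (fun i => (a i : ℂ)) * Uᴴ).trace.re =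
      ∑ i, ∑ j, Complex.normSq ((Uᴴ * V) i j) * a i := by
    intro a
    have := trace_mul_of_diagonalization U V a (fun _ => 1)
    simpa [hV'] using this
  have htr : ∑ i, ∑ j, Complex.normSq ((Uᴴ * V) i j) * l i = 1 := by
    rw [← hsum, ← eω, hω.2, Complex.one_re]
  have hent : (ω * (cfc (Real.logb 2) ω - cfc (Real.logb 2) σ)).trace.re =
      ∑ i, ∑ j, Complex.normSq ((Uᴴ * V) i j) * l i * Real.logb 2 (l i / m j) := by
    rw [lω, lσ, Matrix.mul_sub, Matrix.trace_sub, Complex.sub_re, eω,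
      trace_mul_of_diagonalization U V]
    have : U * diagonal (fun i => (l i : ℂ)) * Uᴴ *
        (U * diagonal (fun i => (Real.logb 2 (l i) : ℂ)) * Uᴴ) =
        U * diagonal (fun i => ((l i * Real.logb 2 (l i) : ℝ) : ℂ)) * Uᴴ := by
      calc _ = U * diagonal (fun i => (l i : ℂ)) * (Uᴴ * U) *
            diagonal (fun i => (Real.logb 2 (l i) : ℂ)) * Uᴴ := by simp only [Matrix.mul_assoc]
        _ = _ := by
          rw [hU, Matrix.mul_one, Matrix.mul_assoc U, Matrix.diagonal_mul_diagonal]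
          simp only [Complex.ofReal_mul]
    rw [this, hsum]
    simp only [← Finset.sum_sub_distrib]
    refine Finset.sum_congr rfl fun i _ => Finset.sum_congr rfl fun j _ => ?_
    by_cases hli : l i = 0
    · simp [hli]
    by_cases hmj : m j = 0
    · rw [← mul_assoc, h0 i j hmj]; ring
    rw [Real.logb_div hli hmj]
    ring
  rw [hent] at hR
  obtain ⟨s, hs, hlt⟩ := exists_sum_mul_rpow_lt
    (fun k : ι × ι => Complex.normSq ((Uᴴ * V) k.1 k.2) * l k.1) (fun k => l k.1 / m k.2)
    (by
      rintro ⟨i, j⟩ h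
      rcases div_eq_zero_iff.mp h with h | h
      · simp [show l i = 0 from h]
      · exact h0 i j h)
    (fun k => div_nonneg (hl _) (hm _)) (by rw [Fintype.sum_prod_type]; exact htr)
    (by rw [Fintype.sum_prod_type]; exact hR)
  refine ⟨s, hs, _, ⟨U, V, l, m, hU, hU', hV, hV', hl, hm, eω, eσ, h0, rfl⟩, ?_⟩
  rw [Fintype.sum_prod_type] at hlt
  exact hlt

end

/-! ### Trace norm and fidelity -/

section
variable {ι : Type} [Fintype ι] [DecidableEq ι]

omit [DecidableEq ι] in
lemma trace_conjTranspose_mul_self_re_nonneg {κ : Type} [Fintype κ] (A : Matrix κ ι ℂ) :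
    0 ≤ (Aᴴ * A).trace.re :=
  (Complex.le_def.mp (posSemidef_conjTranspose_mul_self A).trace_nonneg).1

-- Cauchy–Schwarz for the Hilbert–Schmidt product, from the discriminant of `‖A - cB*‖² ≥ 0` in `c`.
omit [DecidableEq ι] in
lemma trace_mul_re_sq_le (A B : Op ι) :
    (A * B).trace.re ^ 2 ≤ (Aᴴ * A).trace.re * (Bᴴ * B).trace.re := by
  classical
  have key : ∀ c : ℝ, 0 ≤ (Bᴴ * B).trace.re * (c * c) + (-2 * (A * B).trace.re) * c +
      (Aᴴ * A).trace.re := by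
    intro c
    have h := trace_conjTranspose_mul_self_re_nonneg (A - (c : ℂ) • Bᴴ)
    have e : (B * A).trace.re = (A * B).trace.re := by rw [Matrix.trace_mul_comm]
    have e' : (Aᴴ * Bᴴ).trace.re = (A * B).trace.re := by
      rw [← conjTranspose_mul, trace_conjTranspose, ← e]; simp
    have e'' : (B * Bᴴ).trace.re = (Bᴴ * B).trace.re := by rw [Matrix.trace_mul_comm]
    simp only [conjTranspose_sub, conjTranspose_smul, conjTranspose_conjTranspose, Matrix.sub_mul,
      Matrix.mul_sub, Matrix.smul_mul, Matrix.mul_smul, trace_sub, trace_smul, smul_eq_mul,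
      Complex.sub_re, Complex.star_def, Complex.conj_ofReal, Complex.re_ofReal_mul, e, e', e''] at h
    linarith
  have := discrim_le_zero key
  rw [discrim] at this
  nlinarith

/-- Hölder's inequality. With `C = XY` and `G` the pseudo-inverse of `|C|`, the trace norm is `Tr
X(YGC*)`. Cauchy–Schwarz then suffices, because `CG` is a contraction. -/
lemma traceNorm_mul_sq_le (X Y : Op ι) :
    traceNorm (X * Y) ^ 2 ≤ (Xᴴ * X).trace.re * (Yᴴ * Y).trace.re := by
  set C := X * Y with hC
  have hH : (Cᴴ * C).PosSemidef := posSemidef_conjTranspose_mul_self C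
  set U : Op ι := hH.1.eigenvectorUnitary.1
  set h := hH.1.eigenvalues
  have hU : Uᴴ * U = 1 := Unitary.coe_star_mul_self hH.1.eigenvectorUnitary
  have hU' : U * Uᴴ = 1 := Unitary.coe_mul_star_self hH.1.eigenvectorUnitary
  have eH : Cᴴ * C = U * diagonal (fun i => (h i : ℂ)) * Uᴴ := eq_diagonalization hH.1
  have eS : cfc Real.sqrt (Cᴴ * C) = U * diagonal (fun i => (√(h i) : ℂ)) * Uᴴ :=
    cfc_eq_diagonalization hH.1 _
  have hmul : ∀ a b : ι → ℝ, U * diagonal (fun i => (a i : ℂ)) * Uᴴ *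
      (U * diagonal (fun i => (b i : ℂ)) * Uᴴ) =
      U * diagonal (fun i => ((a i * b i : ℝ) : ℂ)) * Uᴴ := by
    intro a b
    calc _ = U * diagonal (fun i => (a i : ℂ)) * (Uᴴ * U) *
          diagonal (fun i => (b i : ℂ)) * Uᴴ := by simp only [Matrix.mul_assoc]
      _ = _ := by
        rw [hU, Matrix.mul_one, Matrix.mul_assoc U, Matrix.diagonal_mul_diagonal]
        simp only [Complex.ofReal_mul]
  -- Since `0⁻¹ = 0`, this inverts `|C|` on its support and vanishes on the kernel.
  set G := U * diagonal (fun i => (((√(h i))⁻¹ : ℝ) : ℂ)) * Uᴴ with hG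
  have hGh : Gᴴ = G := by
    rw [hG]
    simp only [conjTranspose_mul, conjTranspose_conjTranspose, diagonal_conjTranspose,
      Matrix.mul_assoc]
    congr 3
    ext i
    simp
  have hGH : G * (Cᴴ * C) = cfc Real.sqrt (Cᴴ * C) := by
    rw [eS, eH, hmul]
    congr 3
    ext i
    congr 1
    rw [inv_mul_eq_div, Real.div_sqrt]
  have hP : (1 - G * (Cᴴ * C) * G).PosSemidef := by
    have e1 : (1 : Op ι) = U * diagonal (fun _ => ((1 : ℝ) : ℂ)) * Uᴴ := by
      simp [hU']
    rw [hGH, eS, hmul, e1, ← Matrix.sub_mul, ← Matrix.mul_sub, diagonal_sub]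
    refine (Matrix.PosSemidef.diagonal fun i => ?_).mul_mul_conjTranspose_same U
    rw [Pi.zero_apply, ← Complex.ofReal_sub]
    refine Complex.zero_le_real.mpr (sub_nonneg.mpr ?_)
    exact mul_inv_le_one
  have hT : traceNorm C = (X * (Y * G * Cᴴ)).trace.re := by
    rw [traceNorm, ← hGH, ← Matrix.mul_assoc, Matrix.trace_mul_comm, hC]
    simp only [Matrix.mul_assoc]
  rw [hT]
  refine (trace_mul_re_sq_le _ _).trans (mul_le_mul_of_nonneg_left ?_
    (trace_conjTranspose_mul_self_re_nonneg X))
  have e2 : ((Y * G * Cᴴ)ᴴ * (Y * G * Cᴴ)).trace = (G * (Cᴴ * C) * G * (Yᴴ * Y)).trace := by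
    rw [Matrix.trace_mul_comm, Matrix.trace_mul_comm (G * (Cᴴ * C) * G),
      Matrix.mul_assoc Yᴴ Y, Matrix.trace_mul_comm Yᴴ]
    simp only [conjTranspose_mul, conjTranspose_conjTranspose, hGh, Matrix.mul_assoc]
  have := trace_mul_re_nonneg hP (posSemidef_conjTranspose_mul_self Y)
  rw [Matrix.sub_mul, Matrix.one_mul, Matrix.trace_sub, Complex.sub_re] at this
  rw [e2]
  linarith

lemma cfc_sqrt_mul_self {ρ : Op ι} (h : ρ.PosSemidef) :
    cfc Real.sqrt ρ * cfc Real.sqrt ρ = ρ := by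
  rw [← cfc_mul Real.sqrt Real.sqrt ρ]
  conv_rhs => rw [← cfc_id' ℝ ρ h.1.isSelfAdjoint]
  refine cfc_congr fun x hx => ?_
  rw [h.1.spectrum_real_eq_range_eigenvalues] at hx
  obtain ⟨i, rfl⟩ := hx
  exact Real.mul_self_sqrt (h.eigenvalues_nonneg i)

lemma conjTranspose_cfc (f : ℝ → ℝ) (ρ : Op ι) : (cfc f ρ)ᴴ = cfc f ρ :=
  (cfc_predicate f ρ : IsSelfAdjoint _)

/-- As `P` fixes `γ` it fixes `√γ`, so `√ρ√γ = (√ρ P)√γ`, and Hölder's inequality bounds the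
fidelity by `Tr Pρ · Tr γ`. -/
lemma fidelity_le_trace_projection {ρ γ P : Op ι} (hρ : ρ.PosSemidef) (hγ : IsState γ)
    (hP : Pᴴ = P) (hPP : P * P = P) (hPγ : P * γ = γ) : fidelity ρ γ ≤ (P * ρ).trace.re := by
  set S := cfc Real.sqrt ρ
  set Y := cfc Real.sqrt γ with hY
  have hSS : S * S = ρ := cfc_sqrt_mul_self hρ
  have hYY : Y * Y = γ := cfc_sqrt_mul_self hγ.1
  have hSh : Sᴴ = S := conjTranspose_cfc _ _
  have hYh : Yᴴ = Y := conjTranspose_cfc _ _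
  have hPY : P * Y = Y := by
    -- The product is `(1-P)γ(1-P)`.
    have : (Y - P * Y) * (Y - P * Y)ᴴ = 0 := by
      rw [conjTranspose_sub, conjTranspose_mul, hP, hYh]
      calc (Y - P * Y) * (Y - Y * P) = Y * Y - P * (Y * Y) - (Y * Y - P * (Y * Y)) * P := by
            noncomm_ring
        _ = 0 := by rw [hYY, hPγ]; simp
    exact (sub_eq_zero.mp (self_mul_conjTranspose_eq_zero.mp this)).symm
  have h := traceNorm_mul_sq_le (S * P) Y
  rw [Matrix.mul_assoc, hPY] at h
  have e : ((S * P)ᴴ * (S * P)).trace = (P * ρ).trace := by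
    rw [conjTranspose_mul, hSh, hP, Matrix.trace_mul_comm]
    calc _ = (S * (P * P) * S).trace := by simp only [Matrix.mul_assoc]
      _ = _ := by rw [hPP, Matrix.trace_mul_comm, ← Matrix.mul_assoc, hSS, Matrix.trace_mul_comm]
  rw [e, hYh, hYY, hγ.2, Complex.one_re, mul_one] at h
  exact h

end

/-! ### Separable operators and the privacy test -/

/-- The cone of (unnormalised) separable operators. -/
inductive IsSep {a b : Type} : Op (a × b) → Prop
  | zero : IsSep 0
  | kron (P : Op a) (Q : Op b) (hP : P.PosSemidef) (hQ : Q.PosSemidef) : IsSep (P ⊗ₖ Q)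
  | add (X Y : Op (a × b)) (hX : IsSep X) (hY : IsSep Y) : IsSep (X + Y)

lemma IsSep.sum {a b κ : Type} (s : Finset κ) (X : κ → Op (a × b)) (h : ∀ k ∈ s, IsSep (X k)) :
    IsSep (∑ k ∈ s, X k) :=
  Finset.sum_induction _ _ (fun _ _ => .add _ _) .zero h

lemma IsSep.smul {a b : Type} {X : Op (a × b)} (h : IsSep X) {c : ℝ} (hc : 0 ≤ c) :
    IsSep (c • X) := by
  induction h with
  | zero => rw [smul_zero]; exact .zero
  | kron P Q hP hQ => rw [← smul_kronecker]; exact .kron _ _ (hP.smul hc) hQ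
  | add X Y _ _ ihX ihY => rw [smul_add]; exact .add _ _ ihX ihY

lemma IsSep.posSemidef {a b : Type} [Fintype a] [Fintype b] {X : Op (a × b)} (h : IsSep X) :
    X.PosSemidef := by
  induction h with
  | zero => exact .zero
  | kron P Q hP hQ => exact hP.kronecker hQ
  | add X Y _ _ ihX ihY => exact ihX.add ihY

lemma isSep_of_mem_separableStates {a b : Type} [Fintype a] [Fintype b] {σ : Op (a × b)}
    (h : σ ∈ separableStates a b) : IsSep σ ∧ σ.trace = 1 := by
  have hconv : Convex ℝ {σ : Op (a × b) | IsSep σ ∧ σ.trace = 1} := by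
    rintro X ⟨hX, hX1⟩ Y ⟨hY, hY1⟩ c d hc hd hcd
    refine ⟨.add _ _ (hX.smul hc) (hY.smul hd), ?_⟩
    rw [trace_add, trace_smul, trace_smul, hX1, hY1, ← add_smul, hcd, one_smul]
  refine convexHull_min ?_ hconv h
  rintro _ ⟨φ, χ, hφ, hχ, rfl⟩
  refine ⟨.kron _ _ (posSemidef_vecMulVec_self_star φ) (posSemidef_vecMulVec_self_star χ), ?_⟩
  rw [trace_kronecker, trace_vecMulVec, trace_vecMulVec, dotProduct_comm, hφ, dotProduct_comm, hχ,
    one_mul]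

section
variable {K : ℕ} {sA sB : Type} [Fintype sA] [Fintype sB] [DecidableEq sA] [DecidableEq sB]

/-- The embedding `∑ i, |i⟩ ⊗ |i⟩ ⊗ V i i`, an isometry up to the factor `√K`. -/
def keyEmbedding (V : Fin K → Fin K → Op (sA × sB)) :
    Matrix ((Fin K × sA) × (Fin K × sB)) (sA × sB) ℂ :=
  Matrix.of fun p c => if p.1.1 = p.2.1 then V p.1.1 p.2.1 (p.1.2, p.2.2) c else 0

lemma keyTensorShield_eq (θ : Op (sA × sB)) :
    (keyTensorShield θ : Op ((Fin K × sA) × (Fin K × sB))) =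
      (1 / (K : ℂ)) • (keyEmbedding (fun _ _ : Fin K => (1 : Op (sA × sB))) * θ *
        (keyEmbedding (fun _ _ : Fin K => (1 : Op (sA × sB))))ᴴ) := by
  ext ⟨⟨i, a⟩, ⟨j, b⟩⟩ ⟨⟨i', a'⟩, ⟨j', b'⟩⟩
  simp only [keyTensorShield, keyEmbedding, Matrix.of_apply, Matrix.smul_apply, Matrix.mul_apply,
    Matrix.conjTranspose_apply, Matrix.one_apply, smul_eq_mul]
  by_cases h : i = j <;> by_cases h' : i' = j' <;> simp [h, h']

lemma twisting_mul_keyEmbedding (V : Fin K → Fin K → Op (sA × sB)) :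
    twisting V * keyEmbedding (fun _ _ : Fin K => (1 : Op (sA × sB))) = keyEmbedding V := by
  ext ⟨⟨i, a⟩, ⟨j, b⟩⟩ ⟨c, d⟩
  simp only [twisting, keyEmbedding, Matrix.of_apply, Matrix.mul_apply, Matrix.one_apply,
    Fintype.sum_prod_type]
  by_cases h : i = j
  · subst h
    simp only [Prod.mk.injEq, mul_ite, mul_one, mul_zero, ite_and]
    simp
  · simp only [Prod.mk.injEq, mul_ite, mul_one, mul_zero, ite_and]
    simp [h, Ne.symm h]

lemma keyEmbedding_conjTranspose_mul_self {V : Fin K → Fin K → Op (sA × sB)}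
    (hV : ∀ i j, V i j ∈ unitaryGroup (sA × sB) ℂ) :
    (keyEmbedding V)ᴴ * keyEmbedding V = (K : ℂ) • 1 := by
  have h1 : (keyEmbedding V)ᴴ * keyEmbedding V = ∑ i, (V i i)ᴴ * V i i := by
    ext c d
    simp only [keyEmbedding, Matrix.mul_apply, Matrix.conjTranspose_apply, Matrix.of_apply,
      Matrix.sum_apply]
    simp only [Fintype.sum_prod_type]
    refine Finset.sum_congr rfl fun i _ => Finset.sum_congr rfl fun a _ => ?_
    rw [Finset.sum_eq_single i]
    · simp
    · intro j _ hj
      simp [hj.symm]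
    · simp
  have h2 : ∀ i, (V i i)ᴴ * V i i = 1 := fun i => mem_unitaryGroup_iff'.mp (hV i i)
  rw [h1]
  simp only [h2]
  simp [Nat.cast_smul_eq_nsmul]

/-- The privacy test. -/
noncomputable def privacyTest (V : Fin K → Fin K → Op (sA × sB)) : Op ((Fin K × sA) × (Fin K × sB)) :=
  (1 / (K : ℂ)) • (keyEmbedding V * (keyEmbedding V)ᴴ)

omit [DecidableEq sA] [DecidableEq sB] in
lemma privacyTest_conjTranspose (V : Fin K → Fin K → Op (sA × sB)) :
    (privacyTest V)ᴴ = privacyTest V := by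
  simp [privacyTest, conjTranspose_smul, conjTranspose_mul]

lemma privacyTest_mul_self (hK : 0 < K) {V : Fin K → Fin K → Op (sA × sB)}
    (hV : ∀ i j, V i j ∈ unitaryGroup (sA × sB) ℂ) :
    privacyTest V * privacyTest V = privacyTest V := by
  have hK' : (K : ℂ) ≠ 0 := by exact_mod_cast hK.ne'
  have : keyEmbedding V * (keyEmbedding V)ᴴ * (keyEmbedding V * (keyEmbedding V)ᴴ) =
      (K : ℂ) • (keyEmbedding V * (keyEmbedding V)ᴴ) := by
    rw [Matrix.mul_assoc, ← Matrix.mul_assoc (keyEmbedding V)ᴴ,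
      keyEmbedding_conjTranspose_mul_self hV]
    simp
  rw [privacyTest, Matrix.smul_mul, Matrix.mul_smul, this, smul_smul, smul_smul]
  congr 1
  field_simp

omit [DecidableEq sA] [DecidableEq sB] in
lemma privacyTest_posSemidef (V : Fin K → Fin K → Op (sA × sB)) :
    (privacyTest V).PosSemidef :=
  (posSemidef_self_mul_conjTranspose _).smul (by
    have : (1 / (K : ℂ)) = ((1 / (K : ℝ) : ℝ) : ℂ) := by push_cast; rfl
    rw [this]
    exact Complex.zero_le_real.mpr (by positivity))

lemma one_sub_privacyTest_posSemidef (hK : 0 < K) {V : Fin K → Fin K → Op (sA × sB)}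
    (hV : ∀ i j, V i j ∈ unitaryGroup (sA × sB) ℂ) : (1 - privacyTest V).PosSemidef := by
  have : 1 - privacyTest V = (1 - privacyTest V)ᴴ * (1 - privacyTest V) := by
    rw [conjTranspose_sub, conjTranspose_one, privacyTest_conjTranspose, Matrix.sub_mul,
      Matrix.mul_sub, Matrix.mul_sub, privacyTest_mul_self hK hV]
    simp
  rw [this]
  exact posSemidef_conjTranspose_mul_self _

/-- On the support of `Φ` the two key values agree, so only the unitaries `V i i` act. The private
state is thus supported on the range of `keyEmbedding V`, onto which the privacy test projects. -/
lemma privateState_eq (V : Fin K → Fin K → Op (sA × sB)) (θ : Op (sA × sB)) :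
    twisting V * keyTensorShield θ * (twisting V)ᴴ =
      (1 / (K : ℂ)) • (keyEmbedding V * θ * (keyEmbedding V)ᴴ) := by
  rw [keyTensorShield_eq, ← twisting_mul_keyEmbedding V, conjTranspose_mul, Matrix.mul_smul,
    Matrix.smul_mul]
  simp only [Matrix.mul_assoc]

/-- A private state passes its privacy test with certainty, so the fidelity to it is at most the
probability of passing the test. -/
lemma exists_privacyTest (hK : 0 < K) {γ : Op ((Fin K × sA) × (Fin K × sB))}
    (hγ : IsPrivateState γ) : ∃ V : Fin K → Fin K → Op (sA × sB),
    (∀ i j, V i j ∈ unitaryGroup (sA × sB) ℂ) ∧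
    ∀ ρ : Op ((Fin K × sA) × (Fin K × sB)), ρ.PosSemidef →
      fidelity ρ γ ≤ (privacyTest V * ρ).trace.re := by
  obtain ⟨V, θ, hV, hθ, rfl⟩ := hγ
  have hK' : (K : ℂ) ≠ 0 := by exact_mod_cast hK.ne'
  have hK0 : 0 ≤ (1 / (K : ℂ)) := by
    have : (1 / (K : ℂ)) = ((1 / (K : ℝ) : ℝ) : ℂ) := by push_cast; rfl
    rw [this]
    exact Complex.zero_le_real.mpr (by positivity)
  refine ⟨V, hV, fun ρ hρ => ?_⟩
  rw [privateState_eq]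
  refine fidelity_le_trace_projection hρ ⟨?_, ?_⟩ (privacyTest_conjTranspose V)
    (privacyTest_mul_self hK hV) ?_
  · exact (hθ.1.mul_mul_conjTranspose_same _).smul hK0
  · rw [trace_smul, Matrix.trace_mul_comm, ← Matrix.mul_assoc,
      keyEmbedding_conjTranspose_mul_self hV, Matrix.smul_mul, Matrix.one_mul, trace_smul, hθ.2,
      smul_smul, smul_eq_mul]
    field_simp
  · rw [privacyTest, Matrix.smul_mul, Matrix.mul_smul, smul_smul]
    have : keyEmbedding V * (keyEmbedding V)ᴴ * (keyEmbedding V * θ * (keyEmbedding V)ᴴ) =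
        (K : ℂ) • (keyEmbedding V * θ * (keyEmbedding V)ᴴ) := by
      calc _ = keyEmbedding V * ((keyEmbedding V)ᴴ * keyEmbedding V) * θ * (keyEmbedding V)ᴴ := by
            simp only [Matrix.mul_assoc]
        _ = _ := by rw [keyEmbedding_conjTranspose_mul_self hV]; simp
    rw [this, smul_smul]
    congr 1
    field_simp

end

/-! ### Separable operators under the privacy test -/

section
variable {K : ℕ} {sA sB : Type} [Fintype sA] [Fintype sB] [DecidableEq sA] [DecidableEq sB]

lemma star_dotProduct_self_re {ι : Type} [Fintype ι] (v : ι → ℂ) :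
    (star v ⬝ᵥ v).re = ‖WithLp.toLp 2 v‖ ^ 2 := by
  rw [EuclideanSpace.norm_sq_eq, dotProduct, Complex.re_sum]
  refine Finset.sum_congr rfl fun i _ => ?_
  simp only [Pi.star_apply, Complex.star_def, ← Complex.normSq_eq_conj_mul_self,
    Complex.ofReal_re, Complex.normSq_eq_norm_sq]

lemma norm_conjTranspose_mulVec {ι : Type} [Fintype ι] [DecidableEq ι] {U : Op ι}
    (hU : U ∈ unitaryGroup ι ℂ) (v : ι → ℂ) :
    ‖WithLp.toLp 2 (Uᴴ *ᵥ v)‖ = ‖WithLp.toLp 2 v‖ := by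
  have h : ‖WithLp.toLp 2 (Uᴴ *ᵥ v)‖ ^ 2 = ‖WithLp.toLp 2 v‖ ^ 2 := by
    rw [← star_dotProduct_self_re, ← star_dotProduct_self_re, star_mulVec,
      conjTranspose_conjTranspose, dotProduct_mulVec, vecMul_vecMul]
    have : U * Uᴴ = 1 := mem_unitaryGroup_iff.mp hU
    rw [this, vecMul_one]
  exact (pow_left_inj₀ (norm_nonneg _) (norm_nonneg _) two_ne_zero).mp h

/-- The left side is `‖∑ i, (V i i)*(φ_i ⊗ χ_i)‖²`, where `φ_i` and `χ_i` are the blocks with key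
value `i`. Unitarity and the triangle inequality bound the norm by `∑ ‖φ_i‖‖χ_i‖`, and
Cauchy–Schwarz bounds this by `‖φ‖‖χ‖`. -/
lemma privacyTest_product_le {V : Fin K → Fin K → Op (sA × sB)}
    (hV : ∀ i j, V i j ∈ unitaryGroup (sA × sB) ℂ) (φ : Fin K × sA → ℂ) (χ : Fin K × sB → ℂ) :
    (keyEmbedding V * (keyEmbedding V)ᴴ *
      (vecMulVec φ (star φ) ⊗ₖ vecMulVec χ (star χ))).trace.re ≤
      (vecMulVec φ (star φ) ⊗ₖ vecMulVec χ (star χ)).trace.re := by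
  set w : Fin K → sA × sB → ℂ := fun i c => φ (i, c.1) * χ (i, c.2) with hw
  set z : (Fin K × sA) × (Fin K × sB) → ℂ := fun p => φ p.1 * χ p.2 with hz
  have ez : vecMulVec φ (star φ) ⊗ₖ vecMulVec χ (star χ) = vecMulVec z (star z) := by
    ext p q
    simp only [kroneckerMap_apply, vecMulVec_apply, hz, Pi.star_apply, star_mul']
    ring
  have eS : (keyEmbedding V)ᴴ *ᵥ z = ∑ i, (V i i)ᴴ *ᵥ w i := by
    ext c
    simp only [mulVec, dotProduct, Finset.sum_apply, Fintype.sum_prod_type, conjTranspose_apply,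
      keyEmbedding, Matrix.of_apply, hz, hw]
    refine Finset.sum_congr rfl fun i _ => Finset.sum_congr rfl fun a _ => ?_
    rw [Finset.sum_eq_single i]
    · simp
    · intro j _ hj
      simp [hj.symm]
    · simp
  have e1 : (keyEmbedding V * (keyEmbedding V)ᴴ * vecMulVec z (star z)).trace.re =
      ‖WithLp.toLp 2 ((keyEmbedding V)ᴴ *ᵥ z)‖ ^ 2 := by
    rw [← star_dotProduct_self_re, star_mulVec, conjTranspose_conjTranspose, Matrix.mul_assoc,
      Matrix.trace_mul_comm, Matrix.mul_vecMulVec, Matrix.vecMulVec_mul, trace_vecMulVec,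
      dotProduct_comm]
  have e2 : (vecMulVec φ (star φ) ⊗ₖ vecMulVec χ (star χ)).trace.re =
      (∑ i, ∑ a, ‖φ (i, a)‖ ^ 2) * ∑ i, ∑ b, ‖χ (i, b)‖ ^ 2 := by
    rw [trace_kronecker, trace_vecMulVec, trace_vecMulVec, dotProduct_comm, dotProduct_comm χ]
    have : ∀ {ι : Type} [Fintype ι] (v : ι → ℂ), (star v ⬝ᵥ v) = ((∑ i, ‖v i‖ ^ 2 : ℝ) : ℂ) := by
      intro ι _ v
      rw [dotProduct]
      push_cast
      refine Finset.sum_congr rfl fun i _ => ?_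
      simp only [Pi.star_apply, Complex.star_def, ← Complex.normSq_eq_conj_mul_self,
        Complex.normSq_eq_norm_sq]
      push_cast
      rfl
    rw [this, this, ← Complex.ofReal_mul, Complex.ofReal_re, Fintype.sum_prod_type,
      Fintype.sum_prod_type]
  have e3 : ∀ i, ‖WithLp.toLp 2 (w i)‖ =
      √(∑ a, ‖φ (i, a)‖ ^ 2) * √(∑ b, ‖χ (i, b)‖ ^ 2) := by
    intro i
    rw [EuclideanSpace.norm_eq, ← Real.sqrt_mul (by positivity), Finset.sum_mul_sum,
      Fintype.sum_prod_type]
    simp only [hw, norm_mul, mul_pow]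
  rw [e2, ez, e1, eS, WithLp.toLp_sum]
  have h1 : ‖∑ i, WithLp.toLp 2 ((V i i)ᴴ *ᵥ w i)‖ ≤
      ∑ i, √(∑ a, ‖φ (i, a)‖ ^ 2) * √(∑ b, ‖χ (i, b)‖ ^ 2) := by
    refine (norm_sum_le _ _).trans_eq (Finset.sum_congr rfl fun i _ => ?_)
    rw [norm_conjTranspose_mulVec (hV i i), e3]
  refine (pow_le_pow_left₀ (norm_nonneg _) h1 2).trans ?_
  refine (Finset.sum_mul_sq_le_sq_mul_sq _ _ _).trans_eq ?_
  congr 1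
  · exact Finset.sum_congr rfl fun i _ => Real.sq_sqrt (by positivity)
  · exact Finset.sum_congr rfl fun i _ => Real.sq_sqrt (by positivity)

/-- A separable operator passes the privacy test for `K` key values with relative weight at most
`1 / K`. -/
lemma IsSep.privacyTest_le {V : Fin K → Fin K → Op (sA × sB)}
    (hV : ∀ i j, V i j ∈ unitaryGroup (sA × sB) ℂ) {X : Op ((Fin K × sA) × (Fin K × sB))}
    (hX : IsSep X) : (privacyTest V * X).trace.re ≤ 1 / (K : ℝ) * X.trace.re := by
  have key : (keyEmbedding V * (keyEmbedding V)ᴴ * X).trace.re ≤ X.trace.re := by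
    induction hX with
    | zero => simp
    | add X Y _ _ hX hY =>
      rw [Matrix.mul_add, trace_add, trace_add, Complex.add_re, Complex.add_re]
      exact add_le_add hX hY
    | kron P Q hP hQ =>
      obtain ⟨k, φ, rfl⟩ := posSemidef_iff_eq_sum_vecMulVec.mp hP
      obtain ⟨k', χ, rfl⟩ := posSemidef_iff_eq_sum_vecMulVec.mp hQ
      have e : (∑ i, vecMulVec (φ i) (star (φ i))) ⊗ₖ (∑ j, vecMulVec (χ j) (star (χ j))) =
          ∑ i, ∑ j, vecMulVec (φ i) (star (φ i)) ⊗ₖ vecMulVec (χ j) (star (χ j)) := by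
        ext p q
        simp only [kroneckerMap_apply, Matrix.sum_apply, Finset.sum_mul_sum]
      rw [e]
      simp only [Matrix.mul_sum, Matrix.trace_sum, Complex.re_sum]
      exact Finset.sum_le_sum fun i _ => Finset.sum_le_sum fun j _ =>
        privacyTest_product_le hV _ _
  have hc : (1 / (K : ℂ)) = ((1 / (K : ℝ) : ℝ) : ℂ) := by push_cast; rfl
  rw [privacyTest, Matrix.smul_mul, trace_smul, smul_eq_mul, hc, Complex.re_ofReal_mul]
  exact mul_le_mul_of_nonneg_left key (by positivity)

end

/-! ### Kraus representations -/

section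
variable {a b c d a' b' : Type}

/-- Matrix units of a tensor product are products of matrix units, and scalars can be absorbed into
one factor. Linear identities therefore need checking only on product operators. -/
lemma kronecker_induction [Fintype a] [Fintype b] {p : Op (a × b) → Prop}
    (hadd : ∀ X Y, p X → p Y → p (X + Y)) (hkron : ∀ X Y, p (X ⊗ₖ Y)) (X : Op (a × b)) : p X := by
  classical
  have h0 : p 0 := by simpa using hkron 0 0
  rw [matrix_eq_sum_single X]
  refine Finset.sum_induction _ _ hadd h0 fun i _ => Finset.sum_induction _ _ hadd h0 fun j _ => ?_
  have : single i j (X i j) = single i.1 j.1 (X i j) ⊗ₖ single i.2 j.2 (1 : ℂ) := by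
    rw [kroneckerMap_single_single _ _ _ _ _ (by simp) (by simp), mul_one]
  rw [this]
  exact hkron _ _

lemma tensorMap_kronecker (N : Op a →ₗ[ℂ] Op c) (M : Op b →ₗ[ℂ] Op d) (X : Op a) (Y : Op b) :
    tensorMap N M (X ⊗ₖ Y) = N X ⊗ₖ M Y := by
  ext p q
  simp only [tensorMap, LinearMap.coe_mk, AddHom.coe_mk, Matrix.of_apply, kroneckerMap_apply]
  have h : ∀ k k', (Matrix.of fun l l' => X k k' * Y l l') = X k k' • Y := fun k k' => rfl
  have h2 : (Matrix.of fun k k' => M (Matrix.of fun l l' => X k k' * Y l l') p.2 q.2) =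
      M Y p.2 q.2 • X := by
    ext k k'
    rw [Matrix.of_apply, h, map_smul, Matrix.smul_apply, Matrix.smul_apply, smul_eq_mul,
      smul_eq_mul, mul_comm]
  rw [h2, map_smul, Matrix.smul_apply, smul_eq_mul, mul_comm]

/-- The completely positive map with Kraus operators `A k`. -/
def krausMap {κ : Type} [Fintype κ] [Fintype a] (A : κ → Matrix b a ℂ) : Op a →ₗ[ℂ] Op b where
  toFun X := ∑ k, A k * X * (A k)ᴴ
  map_add' X Y := by
    simp only [Matrix.mul_add, Matrix.add_mul, Finset.sum_add_distrib]
  map_smul' r X := by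
    simp only [Matrix.mul_smul, Matrix.smul_mul, Finset.smul_sum, RingHom.id_apply]

lemma krausMap_apply {κ : Type} [Fintype κ] [Fintype a] (A : κ → Matrix b a ℂ) (X : Op a) :
    krausMap A X = ∑ k, A k * X * (A k)ᴴ := rfl

/-- `N` has a Kraus representation. -/
def HasKraus [Fintype a] (N : Op a →ₗ[ℂ] Op b) : Prop :=
  ∃ (κ : Type) (_ : Fintype κ) (A : κ → Matrix b a ℂ), N = krausMap A

/-- `Λ` has a Kraus representation by product operators. -/
def IsSepMap [Fintype a] [Fintype b] (Λ : Op (a × b) →ₗ[ℂ] Op (a' × b')) : Prop :=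
  ∃ (κ : Type) (_ : Fintype κ) (S : κ → Matrix a' a ℂ) (R : κ → Matrix b' b ℂ),
    Λ = krausMap fun k => S k ⊗ₖ R k

lemma IsSepMap.hasKraus [Fintype a] [Fintype b] {Λ : Op (a × b) →ₗ[ℂ] Op (a' × b')}
    (h : IsSepMap Λ) : HasKraus Λ := by
  obtain ⟨κ, _, S, R, rfl⟩ := h
  exact ⟨κ, _, _, rfl⟩

lemma krausMap_comp {κ κ' : Type} [Fintype κ] [Fintype κ'] [Fintype a] [Fintype b]
    (A : κ → Matrix b a ℂ) (A' : κ' → Matrix c b ℂ) :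
    krausMap A' ∘ₗ krausMap A = krausMap fun k : κ' × κ => A' k.1 * A k.2 := by
  ext1 X
  simp only [LinearMap.comp_apply, krausMap_apply, Fintype.sum_prod_type, Matrix.mul_sum,
    Matrix.sum_mul, conjTranspose_mul, Matrix.mul_assoc]

lemma HasKraus.comp [Fintype a] [Fintype b] {N : Op a →ₗ[ℂ] Op b} {M : Op b →ₗ[ℂ] Op c}
    (hM : HasKraus M) (hN : HasKraus N) : HasKraus (M ∘ₗ N) := by
  obtain ⟨κ, _, A, rfl⟩ := hN
  obtain ⟨κ', _, A', rfl⟩ := hM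
  exact ⟨κ' × κ, inferInstance, _, krausMap_comp A A'⟩

lemma IsSepMap.comp [Fintype a] [Fintype b] [Fintype c] [Fintype d]
    {Λ : Op (a × b) →ₗ[ℂ] Op (c × d)} {Γ : Op (c × d) →ₗ[ℂ] Op (a' × b')}
    (hΓ : IsSepMap Γ) (hΛ : IsSepMap Λ) : IsSepMap (Γ ∘ₗ Λ) := by
  obtain ⟨κ, _, S, R, rfl⟩ := hΛ
  obtain ⟨κ', _, S', R', rfl⟩ := hΓ
  refine ⟨κ' × κ, inferInstance, fun k => S' k.1 * S k.2, fun k => R' k.1 * R k.2, ?_⟩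
  rw [krausMap_comp]
  simp only [mul_kronecker_mul]

lemma IsSepMap.sum [Fintype a] [Fintype b] {m : Type} [Fintype m]
    {Λ : m → Op (a × b) →ₗ[ℂ] Op (a' × b')} (h : ∀ x, IsSepMap (Λ x)) :
    IsSepMap (∑ x, Λ x) := by
  choose κ hκ S R hΛ using h
  refine ⟨(x : m) × κ x, inferInstance, fun k => S k.1 k.2, fun k => R k.1 k.2, ?_⟩
  ext1 X
  rw [LinearMap.sum_apply, krausMap_apply, Fintype.sum_sigma]
  refine Finset.sum_congr rfl fun x _ => ?_
  rw [hΛ x, krausMap_apply]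

lemma krausMap_kronecker_apply {κ : Type} [Fintype κ] [Fintype a] [Fintype b]
    (S : κ → Matrix a' a ℂ) (R : κ → Matrix b' b ℂ) (X : Op a) (Y : Op b) :
    krausMap (fun k => S k ⊗ₖ R k) (X ⊗ₖ Y) =
      ∑ k, (S k * X * (S k)ᴴ) ⊗ₖ (R k * Y * (R k)ᴴ) := by
  simp only [krausMap_apply, conjTranspose_kronecker, ← mul_kronecker_mul]

lemma kronecker_sum_left {κ : Type} (s : Finset κ) (X : κ → Op a) (Y : Op b) :
    (∑ k ∈ s, X k) ⊗ₖ Y = ∑ k ∈ s, X k ⊗ₖ Y := by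
  ext p q
  simp only [kroneckerMap_apply, Matrix.sum_apply, Finset.sum_mul]

lemma kronecker_sum_right {κ : Type} (s : Finset κ) (X : Op a) (Y : κ → Op b) :
    X ⊗ₖ (∑ k ∈ s, Y k) = ∑ k ∈ s, X ⊗ₖ Y k := by
  ext p q
  simp only [kroneckerMap_apply, Matrix.sum_apply, Finset.mul_sum]

lemma HasKraus.tensorMap [Fintype a] [Fintype b] {N : Op a →ₗ[ℂ] Op c} {M : Op b →ₗ[ℂ] Op d}
    (hN : HasKraus N) (hM : HasKraus M) : IsSepMap (tensorMap N M) := by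
  obtain ⟨κ, _, A, rfl⟩ := hN
  obtain ⟨κ', _, A', rfl⟩ := hM
  refine ⟨κ × κ', inferInstance, fun k => A k.1, fun k => A' k.2, ?_⟩
  ext1 X
  induction X using kronecker_induction with
  | hadd X Y hX hY => rw [map_add, map_add, hX, hY]
  | hkron X Y =>
    rw [tensorMap_kronecker, krausMap_kronecker_apply, Fintype.sum_prod_type, krausMap_apply,
      krausMap_apply, kronecker_sum_left]
    simp only [kronecker_sum_right]

lemma hasKraus_id [Fintype a] : HasKraus (LinearMap.id : Op a →ₗ[ℂ] Op a) := by
  classical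
  refine ⟨Unit, inferInstance, fun _ => 1, ?_⟩
  ext1 X
  simp [krausMap_apply]

lemma hasKraus_reindex [Fintype a] (e : a ≃ b) :
    HasKraus (Matrix.reindexLinearEquiv ℂ ℂ e e).toLinearMap := by
  classical
  refine ⟨Unit, inferInstance, fun _ => (1 : Op a).submatrix e.symm id, ?_⟩
  ext1 X
  simp only [krausMap_apply, Finset.univ_unique, Finset.sum_singleton, conjTranspose_submatrix,
    conjTranspose_one]
  have h1 : (1 : Op a).submatrix e.symm id * X = X.submatrix e.symm id := by
    have := Matrix.submatrix_mul (1 : Op a) X e.symm id id Function.bijective_id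
    simpa using this.symm
  have h2 : X.submatrix e.symm id * (1 : Op a).submatrix id e.symm =
      X.submatrix e.symm e.symm := by
    have := Matrix.submatrix_mul X (1 : Op a) e.symm id e.symm Function.bijective_id
    simpa using this.symm
  rw [h1, h2]
  rfl

/-- Choi's theorem. -/
lemma IsCP.hasKraus [Fintype a] [Fintype b] {N : Op a →ₗ[ℂ] Op b} (h : IsCP N) : HasKraus N := by
  classical
  set r := Fintype.card a
  let e : a ≃ Fin r := Fintype.equivFin a
  -- The unnormalised maximally entangled vector, so that `hJ` says that the Choi matrix is
  -- positive.
  let v : Fin r × a → ℂ := fun p => if p.1 = e p.2 then 1 else 0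
  have hJ := h r (vecMulVec v (star v)) (posSemidef_vecMulVec_self_star v)
  obtain ⟨C, hC⟩ := exists_conjTranspose_mul_self hJ
  -- The Choi matrix is `C*C`; the conjugated rows of `C`, reshaped into matrices, are the Kraus
  -- operators.
  refine ⟨Fin r × b, inferInstance, fun k => Matrix.of fun i l => star (C k (e l, i)), ?_⟩
  refine Matrix.ext_linearMap _ fun l l' => LinearMap.ext fun z => ?_
  simp only [LinearMap.comp_apply, Matrix.singleLinearMap_apply]
  have hz : single l l' z = z • single l l' (1 : ℂ) := by simp
  rw [hz, map_smul, map_smul]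
  congr 1
  ext i i'
  have h1 := congrFun (congrFun hC (e l, i)) (e l', i')
  have h2 : QPriv.tensorMap (LinearMap.id : Op (Fin r) →ₗ[ℂ] Op (Fin r)) N (vecMulVec v (star v))
      (e l, i) (e l', i') = N (single l l' 1) i i' := by
    have : (Matrix.of fun m m' => vecMulVec v (star v) (e l, m) (e l', m')) =
        single l l' (1 : ℂ) := by
      ext m m'
      simp only [Matrix.of_apply, vecMulVec_apply, Pi.star_apply, v, single_apply,
        EmbeddingLike.apply_eq_iff_eq]
      by_cases hm : l = m <;> by_cases hm' : l' = m' <;> simp [hm, hm']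
    rw [← this]
    rfl
  rw [h2] at h1
  rw [h1, Matrix.mul_apply, krausMap_apply, Matrix.sum_apply]
  refine Finset.sum_congr rfl fun k _ => ?_
  rw [Matrix.mul_apply, Finset.sum_eq_single l']
  · rw [Matrix.mul_single_apply_same]
    simp [conjTranspose_apply]
  · intro j _ hj
    rw [Matrix.mul_single_apply_of_ne _ _ _ _ _ hj, zero_mul]
  · simp

/-! ### Trace preservation -/

lemma IsTP.comp [Fintype a] [Fintype b] [Fintype c] {N : Op a →ₗ[ℂ] Op b} {M : Op b →ₗ[ℂ] Op c}
    (hM : IsTP M) (hN : IsTP N) : IsTP (M ∘ₗ N) :=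
  fun X => (hM _).trans (hN X)

lemma IsTP.tensorMap [Fintype a] [Fintype b] [Fintype c] [Fintype d] {N : Op a →ₗ[ℂ] Op c}
    {M : Op b →ₗ[ℂ] Op d} (hN : IsTP N) (hM : IsTP M) : IsTP (tensorMap N M) := by
  intro X
  induction X using kronecker_induction with
  | hadd X Y hX hY => rw [map_add, trace_add, trace_add, hX, hY]
  | hkron X Y => rw [tensorMap_kronecker, trace_kronecker, trace_kronecker, hN, hM]

lemma isTP_reindex [Fintype a] [Fintype b] (e : a ≃ b) :
    IsTP (Matrix.reindexLinearEquiv ℂ ℂ e e).toLinearMap := by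
  intro X
  exact Equiv.sum_comp e.symm fun i => X i i

/-! ### LOCC channels -/

lemma IsAliceToBob.isSepMap_isTP [Fintype a] [Fintype b] [Fintype a'] [Fintype b']
    {Λ : Op (a × b) →ₗ[ℂ] Op (a' × b')} (h : IsAliceToBob Λ) : IsSepMap Λ ∧ IsTP Λ := by
  obtain ⟨m, E, F, hE, hE1, hF, rfl⟩ := h
  refine ⟨IsSepMap.sum fun x => (hE x).hasKraus.tensorMap (hF x).1.hasKraus, fun X => ?_⟩
  induction X using kronecker_induction with
  | hadd X Y hX hY => rw [map_add, trace_add, trace_add, hX, hY]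
  | hkron X Y =>
    rw [LinearMap.sum_apply, trace_sum, trace_kronecker, ← hE1.2 X, LinearMap.sum_apply, trace_sum,
      Finset.sum_mul]
    refine Finset.sum_congr rfl fun x _ => ?_
    rw [tensorMap_kronecker, trace_kronecker, (hF x).2]

lemma IsBobToAlice.isSepMap_isTP [Fintype a] [Fintype b] [Fintype a'] [Fintype b']
    {Λ : Op (a × b) →ₗ[ℂ] Op (a' × b')} (h : IsBobToAlice Λ) : IsSepMap Λ ∧ IsTP Λ := by
  obtain ⟨m, E, F, hE, hF, hF1, rfl⟩ := h
  refine ⟨IsSepMap.sum fun x => (hE x).1.hasKraus.tensorMap (hF x).hasKraus, fun X => ?_⟩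
  induction X using kronecker_induction with
  | hadd X Y hX hY => rw [map_add, trace_add, trace_add, hX, hY]
  | hkron X Y =>
    rw [LinearMap.sum_apply, trace_sum, trace_kronecker, ← hF1.2 Y, LinearMap.sum_apply, trace_sum,
      Finset.mul_sum]
    refine Finset.sum_congr rfl fun x _ => ?_
    rw [tensorMap_kronecker, trace_kronecker, (hE x).2]

/-- The converse uses only these two properties of LOCC, both stable under composition. -/
lemma IsLOCC.isSepMap_isTP [Fintype a] [Fintype b] [Fintype a'] [Fintype b']
    {Λ : Op (a × b) →ₗ[ℂ] Op (a' × b')} (h : IsLOCC Λ) : IsSepMap Λ ∧ IsTP Λ := by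
  induction h with
  | aliceToBob Λ h => exact h.isSepMap_isTP
  | bobToAlice Λ h => exact h.isSepMap_isTP
  | comp Λ Γ _ _ hΛ hΓ => exact ⟨hΓ.1.comp hΛ.1, hΓ.2.comp hΛ.2⟩

lemma IsSepMap.isSep [Fintype a] [Fintype b] [Fintype a'] [Fintype b']
    {Λ : Op (a × b) →ₗ[ℂ] Op (a' × b')}
    (h : IsSepMap Λ) {X : Op (a × b)} (hX : IsSep X) : IsSep (Λ X) := by
  obtain ⟨κ, _, S, R, rfl⟩ := h
  induction hX with
  | zero => rw [map_zero]; exact .zero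
  | add X Y _ _ hX hY => rw [map_add]; exact .add _ _ hX hY
  | kron P Q hP hQ =>
    rw [krausMap_kronecker_apply]
    exact IsSep.sum _ _ fun k _ =>
      .kron _ _ (hP.mul_mul_conjTranspose_same _) (hQ.mul_mul_conjTranspose_same _)

/-- The adjoint of a channel maps tests to tests. -/
lemma HasKraus.exists_test [Fintype a] [Fintype b] [DecidableEq a] [DecidableEq b]
    {N : Op a →ₗ[ℂ] Op b} (h : HasKraus N) (hTP : IsTP N) {T : Op b} (hT : T.PosSemidef)
    (hT1 : (1 - T).PosSemidef) :
    ∃ T' : Op a, T'.PosSemidef ∧ (1 - T').PosSemidef ∧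
      ∀ X, (T' * X).trace = (T * N X).trace := by
  obtain ⟨κ, _, A, rfl⟩ := h
  have key : ∀ (Y : Op b) (X : Op a),
      ((∑ k, (A k)ᴴ * Y * A k) * X).trace = (Y * krausMap A X).trace := by
    intro Y X
    simp only [krausMap_apply, Matrix.sum_mul, Matrix.mul_sum, trace_sum]
    refine Finset.sum_congr rfl fun k _ => ?_
    rw [Matrix.mul_assoc, Matrix.mul_assoc, Matrix.trace_mul_comm]
    simp only [Matrix.mul_assoc]
  -- Trace preservation is unitality of the adjoint; it carries `1 - T ≥ 0` to the pulled-back test.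
  have h1 : ∑ k, (A k)ᴴ * (1 : Op b) * A k = 1 := by
    refine Matrix.ext_iff_trace_mul_right.mpr fun X => ?_
    rw [key, Matrix.one_mul, Matrix.one_mul, hTP]
  have hpos : ∀ Y : Op b, Y.PosSemidef → (∑ k, (A k)ᴴ * Y * A k).PosSemidef :=
    fun Y hY => posSemidef_sum _ fun k _ => hY.conjTranspose_mul_mul_same _
  refine ⟨_, hpos T hT, ?_, key T⟩
  have := hpos _ hT1
  simp only [Matrix.mul_sub, Matrix.sub_mul, Finset.sum_sub_distrib] at this
  rwa [h1] at this

end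

/-! ### Reduction of adaptive protocols by teleportation -/

section
variable {a b c : Type}

/-- Pure states span the space of operators. -/
lemma linearMap_ext_states [Fintype a] {f g : Op a →ₗ[ℂ] Op b}
    (h : ∀ ρ, IsState ρ → f ρ = g ρ) : f = g := by
  classical
  have h1 : ∀ v : a → ℂ, f (vecMulVec v (star v)) = g (vecMulVec v (star v)) := by
    intro v
    have ht : (vecMulVec v (star v)).trace = star v ⬝ᵥ v := by
      rw [trace_vecMulVec, dotProduct_comm]
    by_cases hv : star v ⬝ᵥ v = 0
    · rw [dotProduct_star_self_eq_zero.mp hv]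
      simp
    · have hpos : 0 ≤ (star v ⬝ᵥ v)⁻¹ := inv_nonneg.mpr (dotProduct_star_self_nonneg v)
      have := h ((star v ⬝ᵥ v)⁻¹ • vecMulVec v (star v))
        ⟨(posSemidef_vecMulVec_self_star v).smul hpos, by
          rw [trace_smul, ht, smul_eq_mul, inv_mul_cancel₀ hv]⟩
      rw [map_smul, map_smul] at this
      exact smul_right_injective _ (inv_ne_zero hv) this
  have h2 : ∀ v w : a → ℂ, vecMulVec v (star w) = (4 : ℂ)⁻¹ •
      (vecMulVec (v + w) (star (v + w)) + Complex.I • vecMulVec (v + Complex.I • w)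
        (star (v + Complex.I • w)) - vecMulVec (v - w) (star (v - w)) -
        Complex.I • vecMulVec (v - Complex.I • w) (star (v - Complex.I • w))) := by
    intro v w
    ext i j
    simp only [vecMulVec_apply, Matrix.smul_apply, Matrix.add_apply, Matrix.sub_apply,
      Pi.star_apply, Pi.add_apply, Pi.sub_apply, Pi.smul_apply, smul_eq_mul, star_add, star_sub,
      star_mul', Complex.star_def, Complex.conj_I]
    ring_nf
    simp only [Complex.I_sq]
    ring
  refine Matrix.ext_linearMap _ fun i j => LinearMap.ext fun z => ?_
  simp only [LinearMap.comp_apply, Matrix.singleLinearMap_apply]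
  have h3 : single i j z = z • vecMulVec (Pi.single i 1) (star (Pi.single j (1 : ℂ))) := by
    ext k l
    simp only [single_apply, Matrix.smul_apply, vecMulVec_apply, Pi.star_apply, Pi.single_apply,
      smul_eq_mul]
    by_cases hk : i = k <;> by_cases hl : j = l <;> simp [hk, hl, Ne.symm]
  rw [h3, h2]
  simp only [map_smul, map_sub, map_add, h1]

lemma traceFst_add [Fintype a] (X Y : Op (a × b)) :
    traceFst (X + Y) = traceFst X + traceFst Y := by
  ext i j
  simp [traceFst, Finset.sum_add_distrib]

lemma traceFst_smul [Fintype a] (r : ℂ) (X : Op (a × b)) :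
    traceFst (r • X) = r • traceFst X := by
  ext i j
  simp [traceFst, Finset.mul_sum]

lemma traceFst_kronecker [Fintype a] (X : Op a) (Y : Op b) :
    traceFst (X ⊗ₖ Y) = X.trace • Y := by
  ext i j
  simp [traceFst, Matrix.trace, Finset.sum_mul]

/-! ### Teleportation as a separable map -/

section
variable {A A' B : Type} [Fintype A] [Fintype A'] [Fintype B] [DecidableEq B] {m : ℕ}

lemma teleport_kronecker (M : Fin m → Op (A' × A)) (D : Fin m → Op B →ₗ[ℂ] Op B) (Y : Op A')
    (α : Op A) (β : Op B) :
    teleport M D Y (α ⊗ₖ β) = ∑ x, (M x * (Y ⊗ₖ α)).trace • D x β := by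
  refine Finset.sum_congr rfl fun x _ => ?_
  have : (Y ⊗ₖ (α ⊗ₖ β)).submatrix (Equiv.prodAssoc A' A B) (Equiv.prodAssoc A' A B) =
      (Y ⊗ₖ α) ⊗ₖ β := by
    ext p q
    simp [mul_assoc]
  rw [this, ← mul_kronecker_mul, traceFst_kronecker, map_smul, Matrix.one_mul]

lemma teleport_add_left (M : Fin m → Op (A' × A)) (D : Fin m → Op B →ₗ[ℂ] Op B) (X Y : Op A')
    (ω : Op (A × B)) : teleport M D (X + Y) ω = teleport M D X ω + teleport M D Y ω := by
  simp only [teleport, add_kronecker, Matrix.submatrix_add, Matrix.mul_add, traceFst_add, map_add,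
    Pi.add_apply, Finset.sum_add_distrib]

lemma teleport_add_right (M : Fin m → Op (A' × A)) (D : Fin m → Op B →ₗ[ℂ] Op B) (X : Op A')
    (ω ω' : Op (A × B)) : teleport M D X (ω + ω') = teleport M D X ω + teleport M D X ω' := by
  simp only [teleport, kronecker_add, Matrix.submatrix_add, Matrix.mul_add, traceFst_add, map_add,
    Pi.add_apply, Finset.sum_add_distrib]

lemma teleport_smul_left (M : Fin m → Op (A' × A)) (D : Fin m → Op B →ₗ[ℂ] Op B) (r : ℂ)
    (X : Op A') (ω : Op (A × B)) : teleport M D (r • X) ω = r • teleport M D X ω := by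
  simp only [teleport, smul_kronecker, Matrix.submatrix_smul, Matrix.mul_smul, traceFst_smul,
    map_smul, Pi.smul_apply, Finset.smul_sum]

/-- The simulation is assumed for states only. It is needed for all operators, because a channel
input correlated with other registers is expanded into products of arbitrary operators. -/
lemma eq_teleport {M : Fin m → Op (A' × A)} {D : Fin m → Op B →ₗ[ℂ] Op B} {ω : Op (A × B)}
    {N : Op A' →ₗ[ℂ] Op B} (h : ∀ ρ, IsState ρ → N ρ = teleport M D ρ ω) (Y : Op A') :
    N Y = teleport M D Y ω :=
  LinearMap.congr_fun (linearMap_ext_states h : N =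
    { toFun := fun Y => teleport M D Y ω
      map_add' := fun X Y => teleport_add_left M D X Y ω
      map_smul' := fun r X => teleport_smul_left M D r X ω }) Y

-- Alice's Kraus operators: for a POVM element `C*C`, row `k` of `C` acts on `A'A` as a functional,
-- leaving the register `a` alone. Summing the diagonal entries over `k` gives the outcome weight
-- `Tr C*C(Y ⊗ α)`.
omit [DecidableEq B] in
lemma rowEmbedding_conj [Fintype a] [DecidableEq a] (C : Op (A' × A)) (k : A' × A)
    (X : Op a) (Y : Op A') (α : Op A) :
    (((1 : Op a) ⊗ₖ C.submatrix (fun _ : Unit => k) id).submatrix (fun i => (i, ()))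
      (Equiv.prodAssoc a A' A)) * ((X ⊗ₖ Y) ⊗ₖ α) *
      (((1 : Op a) ⊗ₖ C.submatrix (fun _ : Unit => k) id).submatrix (fun i => (i, ()))
      (Equiv.prodAssoc a A' A))ᴴ = (C * (Y ⊗ₖ α) * Cᴴ) k k • X := by
  have e : (X ⊗ₖ Y) ⊗ₖ α = (X ⊗ₖ (Y ⊗ₖ α)).submatrix (Equiv.prodAssoc a A' A)
      (Equiv.prodAssoc a A' A) := by
    ext p q
    simp [mul_assoc]
  rw [e, conjTranspose_submatrix, Matrix.submatrix_mul_equiv, Matrix.submatrix_mul_equiv,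
    conjTranspose_kronecker, ← mul_kronecker_mul, ← mul_kronecker_mul, conjTranspose_one,
    Matrix.one_mul, Matrix.mul_one]
  ext i j
  rw [Matrix.submatrix_apply, kroneckerMap_apply, Matrix.smul_apply, smul_eq_mul, mul_comm]
  rfl

omit [Fintype A] [Fintype A'] [DecidableEq B] in
lemma swapEmbedding_conj [Fintype b] [DecidableEq b] (L : Op B) (Z : Op b) (β : Op B) :
    ((L ⊗ₖ (1 : Op b)).submatrix id (Equiv.prodComm b B)) * (Z ⊗ₖ β) *
      ((L ⊗ₖ (1 : Op b)).submatrix id (Equiv.prodComm b B))ᴴ = (L * β * Lᴴ) ⊗ₖ Z := by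
  have e : Z ⊗ₖ β = (β ⊗ₖ Z).submatrix (Equiv.prodComm b B) (Equiv.prodComm b B) := by
    ext p q
    simp [mul_comm]
  rw [e, conjTranspose_submatrix, Matrix.submatrix_mul_equiv, Matrix.submatrix_mul_equiv,
    conjTranspose_kronecker, ← mul_kronecker_mul, ← mul_kronecker_mul, conjTranspose_one,
    Matrix.one_mul, Matrix.mul_one, Matrix.submatrix_id_id]

omit [DecidableEq B] in
/-- Teleportation as a trace-preserving separable map on the registers of both parties. -/
lemma exists_teleportMap [DecidableEq A] [DecidableEq A'] {M : Fin m → Op (A' × A)}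
    {D : Fin m → Op B →ₗ[ℂ] Op B}
    (hM : ∀ x, (M x).PosSemidef) (hM1 : ∑ x, M x = 1) (hD : ∀ x, IsChannel (D x))
    (a b : Type) [Fintype a] [Fintype b] :
    ∃ G : Op (((a × A') × A) × (b × B)) →ₗ[ℂ] Op (a × (B × b)), IsSepMap G ∧ IsTP G ∧
      ∀ X Y α Z β, G (((X ⊗ₖ Y) ⊗ₖ α) ⊗ₖ (Z ⊗ₖ β)) =
        ∑ x, ((M x * (Y ⊗ₖ α)).trace • X) ⊗ₖ (D x β ⊗ₖ Z) := by
  classical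
  choose C hC using fun x => exists_conjTranspose_mul_self (hM x)
  choose κ hκ L hL using fun x => (hD x).1.hasKraus
  let S : A' × A → Fin m → Matrix a ((a × A') × A) ℂ := fun k x =>
    ((1 : Op a) ⊗ₖ (C x).submatrix (fun _ : Unit => k) id).submatrix (fun i => (i, ()))
      (Equiv.prodAssoc a A' A)
  let R : (x : Fin m) → κ x → Matrix (B × b) (b × B) ℂ := fun x l =>
    (L x l ⊗ₖ (1 : Op b)).submatrix id (Equiv.prodComm b B)
  -- Outcome `x` is shared by both factors, while the row index `k.1` belongs to Alice and the Kraus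
  -- index `k.2` to Bob's correction.
  let G : Op (((a × A') × A) × (b × B)) →ₗ[ℂ] Op (a × (B × b)) :=
    ∑ x, krausMap fun k : (A' × A) × κ x => S k.1 x ⊗ₖ R x k.2
  have hG : ∀ X Y α Z β, G (((X ⊗ₖ Y) ⊗ₖ α) ⊗ₖ (Z ⊗ₖ β)) =
      ∑ x, ((M x * (Y ⊗ₖ α)).trace • X) ⊗ₖ (D x β ⊗ₖ Z) := by
    intro X Y α Z β
    rw [LinearMap.sum_apply]
    refine Finset.sum_congr rfl fun x _ => ?_
    rw [krausMap_kronecker_apply, Fintype.sum_prod_type, hL x, krausMap_apply, hC x,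
      Matrix.mul_assoc, Matrix.trace_mul_comm, Matrix.trace, Finset.sum_smul, kronecker_sum_left,
      kronecker_sum_left]
    refine Finset.sum_congr rfl fun k _ => ?_
    rw [kronecker_sum_right]
    refine Finset.sum_congr rfl fun l _ => ?_
    rw [rowEmbedding_conj, swapEmbedding_conj, Matrix.diag_apply]
  refine ⟨G, IsSepMap.sum fun x => ⟨_, inferInstance, _, _, rfl⟩, fun W => ?_, hG⟩
  induction W using kronecker_induction with
  | hadd W W' h h' => rw [map_add, trace_add, trace_add, h, h']
  | hkron P Q =>
    induction P using kronecker_induction with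
    | hadd P P' h h' => rw [add_kronecker, map_add, trace_add, trace_add, h, h']
    | hkron P α =>
      induction P using kronecker_induction with
      | hadd P P' h h' => rw [add_kronecker, add_kronecker, map_add, trace_add, trace_add, h, h']
      | hkron X Y =>
        induction Q using kronecker_induction with
        | hadd Q Q' h h' => rw [kronecker_add, map_add, trace_add, trace_add, h, h']
        | hkron Z β =>
          have h1 : (Y ⊗ₖ α).trace = ∑ x, (M x * (Y ⊗ₖ α)).trace := by
            rw [← trace_sum, ← Matrix.sum_mul, hM1, Matrix.one_mul]
          rw [hG, trace_sum]
          simp only [trace_kronecker, trace_smul, (hD _).2 β, smul_eq_mul]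
          rw [trace_kronecker] at h1
          rw [mul_assoc X.trace, h1, Finset.mul_sum, Finset.sum_mul]
          exact Finset.sum_congr rfl fun x _ => by ring

/-- The reordering that gives Alice the `A` part and Bob the `B` part of a shared state. -/
lemma kronecker_reorder {a b A B : Type} (P : Op a) (Q : Op b) (α : Op A) (β : Op B) :
    ((P ⊗ₖ Q) ⊗ₖ (α ⊗ₖ β)).submatrix (Equiv.prodProdProdComm a A b B)
      (Equiv.prodProdProdComm a A b B) = (P ⊗ₖ α) ⊗ₖ (Q ⊗ₖ β) := by
  ext p q
  simp only [Matrix.submatrix_apply, kroneckerMap_apply, Equiv.prodProdProdComm_apply]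
  ring

lemma IsSep.kronecker_reorder {a b A B : Type} [Fintype a] [Fintype b] [Fintype A] [Fintype B]
    {τ : Op (a × b)} {σ : Op (A × B)} (hτ : IsSep τ) (hσ : IsSep σ) :
    IsSep ((τ ⊗ₖ σ).submatrix (Equiv.prodProdProdComm a A b B)
      (Equiv.prodProdProdComm a A b B)) := by
  induction hτ with
  | zero => rw [zero_kronecker, Matrix.submatrix_zero]; exact .zero
  | add X Y _ _ hX hY => rw [add_kronecker, Matrix.submatrix_add]; exact .add _ _ hX hY
  | kron P Q hP hQ =>
    induction hσ with
    | zero => rw [kronecker_zero, Matrix.submatrix_zero]; exact .zero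
    | add X Y _ _ hX hY => rw [kronecker_add, Matrix.submatrix_add]; exact .add _ _ hX hY
    | kron α β hα hβ =>
      rw [QPriv.kronecker_reorder]
      exact .kron _ _ (hP.kronecker hα) (hQ.kronecker hβ)

/-- Both sides are additive in `ρ` and, once `N` is expressed by teleportation, in `ω`. It is enough
to compare them on products, even though neither operator need be one. -/
lemma useChannel_eq [Fintype a] [Fintype b] {M : Fin m → Op (A' × A)}
    {D : Fin m → Op B →ₗ[ℂ] Op B} {ω : Op (A × B)} {N : Op A' →ₗ[ℂ] Op B}
    (hN : ∀ Y, N Y = teleport M D Y ω)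
    {G : Op (((a × A') × A) × (b × B)) →ₗ[ℂ] Op (a × (B × b))}
    (hG : ∀ X Y α Z β, G (((X ⊗ₖ Y) ⊗ₖ α) ⊗ₖ (Z ⊗ₖ β)) =
        ∑ x, ((M x * (Y ⊗ₖ α)).trace • X) ⊗ₖ (D x β ⊗ₖ Z)) (ρ : Op ((a × A') × b)) :
    useChannel N ρ = G ((ρ ⊗ₖ ω).submatrix (Equiv.prodProdProdComm (a × A') A b B)
      (Equiv.prodProdProdComm (a × A') A b B)) := by
  have hadd : ∀ X Y : Op ((a × A') × b),
      useChannel N (X + Y) = useChannel N X + useChannel N Y := fun X Y => by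
    simp only [useChannel, Matrix.submatrix_add, Pi.add_apply, map_add]
  induction ρ using kronecker_induction with
  | hadd X Y hX hY =>
    rw [hadd, hX, hY, add_kronecker, Matrix.submatrix_add, ← map_add]
    rfl
  | hkron P Z =>
    induction P using kronecker_induction with
    | hadd X Y hX hY =>
      rw [add_kronecker, hadd, hX, hY, add_kronecker, Matrix.submatrix_add, ← map_add]
      rfl
    | hkron X Y =>
      have e : ((X ⊗ₖ Y) ⊗ₖ Z).submatrix (Equiv.prodAssoc a A' b).symm
          (Equiv.prodAssoc a A' b).symm = X ⊗ₖ (Y ⊗ₖ Z) := by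
        ext p q
        simp [mul_assoc]
      rw [useChannel, e, tensorMap_kronecker, tensorMap_kronecker, LinearMap.id_apply,
        LinearMap.id_apply, hN]
      -- The channel has left the goal, so `ω` may now range over all operators.
      clear hN
      induction ω using kronecker_induction with
      | hadd ω ω' h h' =>
        rw [teleport_add_right, add_kronecker, kronecker_add, h, h', kronecker_add,
          Matrix.submatrix_add, ← map_add]
        rfl
      | hkron α β =>
        rw [teleport_kronecker, QPriv.kronecker_reorder, hG, kronecker_sum_left,
          kronecker_sum_right]
        refine Finset.sum_congr rfl fun x _ => ?_
        simp only [smul_kronecker, kronecker_smul]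

end

/-- A protocol using a teleportation-simulable channel `n` times is a channel applied to `n` copies
of the associated state `ω`; applied to copies of a separable state, it outputs a separable state. -/
lemma ProtocolOutput.exists_reduction {A A' B : Type} [Fintype A] [Fintype A'] [Fintype B]
    [DecidableEq A] [DecidableEq A'] [DecidableEq B] {N : Op A' →ₗ[ℂ] Op B} {ω σ : Op (A × B)}
    (hsim : TeleportationSimulable N ω) (hσ : IsSep σ) (hσ1 : σ.trace = 1) {s Q : ℝ}
    (hQ : IsPetzQuantity ω σ s Q) {n : ℕ} [Fintype a] [Fintype b] {ρ : Op (a × b)}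
    (h : ProtocolOutput N n ρ) :
    ∃ (ι : Type) (_ : Fintype ι) (_ : DecidableEq ι) (ρ₀ σ₀ : Op ι) (Λ : Op ι →ₗ[ℂ] Op (a × b)),
      HasKraus Λ ∧ IsTP Λ ∧ Λ ρ₀ = ρ ∧ IsSep (Λ σ₀) ∧ σ₀.trace = 1 ∧ ρ₀.PosSemidef ∧
      IsPetzQuantity ρ₀ σ₀ s (Q ^ n) := by
  obtain ⟨hω, -, m, M, D, hM, hM1, hD, hN⟩ := hsim
  induction h with
  | @init a b _ _ Λ hΛ =>
    have h1 : (1 : Op (Unit × Unit)) = (1 : Op Unit) ⊗ₖ (1 : Op Unit) := by simp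
    let e : Unit ≃ Unit × Unit := ⟨fun _ => ((), ()), fun _ => (), fun _ => rfl, fun _ => rfl⟩
    have he : (Matrix.reindexLinearEquiv ℂ ℂ e e).toLinearMap (1 : Op Unit) = 1 := by
      ext p q; rfl
    refine ⟨Unit, inferInstance, inferInstance, 1, 1,
      Λ ∘ₗ (Matrix.reindexLinearEquiv ℂ ℂ e e).toLinearMap,
      hΛ.isSepMap_isTP.1.hasKraus.comp (hasKraus_reindex e),
      hΛ.isSepMap_isTP.2.comp (isTP_reindex e), ?_, ?_, by simp, .one, ?_⟩
    · rw [LinearMap.comp_apply, he]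
    · rw [LinearMap.comp_apply, he, h1]
      exact hΛ.isSepMap_isTP.1.isSep (.kron _ _ .one .one)
    · rw [pow_zero]
      exact isPetzQuantity_one s
  | @use n a b a' b' _ _ _ _ ρ hρ Γ hΓ ih =>
    obtain ⟨ι, _, _, ρ₀, σ₀, Λ, hK, hTP, rfl, hsep, htr, hpos, hPetz⟩ := ih
    obtain ⟨G, hGs, hGt, hG⟩ := exists_teleportMap hM hM1 hD a b
    let e := (Equiv.prodProdProdComm (a × A') A b B).symm
    have hΛ' : ∀ X Y, (Matrix.reindexLinearEquiv ℂ ℂ e e).toLinearMap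
        (tensorMap Λ (LinearMap.id : Op (A × B) →ₗ[ℂ] Op (A × B)) (X ⊗ₖ Y)) =
        (Λ X ⊗ₖ Y).submatrix (Equiv.prodProdProdComm (a × A') A b B)
          (Equiv.prodProdProdComm (a × A') A b B) := by
      intro X Y
      rw [tensorMap_kronecker]
      rfl
    -- One more copy of `ω` (or `σ`): run the earlier reduction on the old copies, hand out the new
    -- one, teleport, then apply the next LOCC channel.
    refine ⟨ι × (A × B), inferInstance, inferInstance, ρ₀ ⊗ₖ ω, σ₀ ⊗ₖ σ,
      Γ ∘ₗ G ∘ₗ (Matrix.reindexLinearEquiv ℂ ℂ e e).toLinearMap ∘ₗ tensorMap Λ LinearMap.id,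
      ?_, ?_, ?_, ?_, ?_, hpos.kronecker hω.1, ?_⟩
    · exact hΓ.isSepMap_isTP.1.hasKraus.comp (hGs.hasKraus.comp
        ((hasKraus_reindex e).comp (hK.tensorMap hasKraus_id).hasKraus))
    · exact hΓ.isSepMap_isTP.2.comp (hGt.comp
        ((isTP_reindex e).comp (hTP.tensorMap fun _ => rfl)))
    · simp only [LinearMap.comp_apply]
      rw [hΛ', useChannel_eq (eq_teleport hN) hG]
    · simp only [LinearMap.comp_apply]
      rw [hΛ']
      exact hΓ.isSepMap_isTP.1.isSep (hGs.isSep (hsep.kronecker_reorder hσ))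
    · rw [trace_kronecker, htr, hσ1, one_mul]
    · rw [pow_succ]
      exact hPetz.kronecker hQ

end

/-! ### The strong converse -/

section
variable {A A' B : Type} [Fintype A] [Fintype A'] [Fintype B]
  [DecidableEq A] [DecidableEq A'] [DecidableEq B]

/-- The pulled-back privacy test is inserted into `IsPetzQuantity.measured_le` with `p ≥ 1-ε` and `q
= 1/K`, and `K ≥ 2^(nR)` is used. -/
lemma rpow_mul_le_of_achievable {N : Op A' →ₗ[ℂ] Op B} {ω σ : Op (A × B)}
    (hsim : TeleportationSimulable N ω) (hσ : IsSep σ) (hσ1 : σ.trace = 1) {s Q R : ℝ}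
    (hs : s ∈ Set.Ioo (0 : ℝ) 1) (hQ : IsPetzQuantity ω σ s Q) {n : ℕ} {ε : ℝ} (hn : 1 ≤ n)
    (h : Achievable N n R ε) (hε : 0 < 1 - ε) :
    (1 - ε) ^ (1 + s) ≤ (Q / (2 : ℝ) ^ (R * s)) ^ n := by
  obtain ⟨-, -, K, sA, sB, ρ, γ, hK, hR, hρ, hγ, hF⟩ := h
  obtain ⟨V, hV, hVF⟩ := exists_privacyTest hK hγ
  obtain ⟨ι, _, _, ρ₀, σ₀, Λ, hΛ, hTP, rfl, hsep, htr, hpos, hPetz⟩ :=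
    hρ.exists_reduction hsim hσ hσ1 hQ
  obtain ⟨T, hT, hT1, hTΛ⟩ := hΛ.exists_test hTP (privacyTest_posSemidef V)
    (one_sub_privacyTest_posSemidef hK hV)
  have hρpos : (Λ ρ₀).PosSemidef := by
    obtain ⟨κ, _, C, rfl⟩ := hΛ
    exact posSemidef_sum _ fun k _ => hpos.mul_mul_conjTranspose_same _
  have hp : 1 - ε ≤ (T * ρ₀).trace.re := by
    rw [hTΛ]
    exact hF.trans (hVF _ hρpos)
  have hK0 : (0 : ℝ) < K := by exact_mod_cast hK
  have hq : (T * σ₀).trace.re ≤ 1 / (K : ℝ) := by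
    have := hsep.privacyTest_le hV
    rwa [hTP, htr, Complex.one_re, mul_one, ← hTΛ] at this
  have hn0 : (0 : ℝ) < n := by exact_mod_cast hn
  have hKR : (2 : ℝ) ^ (n * R) ≤ K := by
    rw [← Real.le_logb_iff_rpow_le one_lt_two hK0]
    rw [one_div, inv_mul_eq_div, le_div_iff₀ hn0] at hR
    linarith
  have hKs : ((2 : ℝ) ^ (R * s)) ^ n ≤ (K : ℝ) ^ s := by
    have := Real.rpow_le_rpow (by positivity) hKR hs.1.le
    rw [← Real.rpow_mul zero_le_two] at this
    rw [← Real.rpow_natCast, ← Real.rpow_mul zero_le_two]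
    convert this using 2
    ring
  have hm := hPetz.measured_le hs hT hT1 (by positivity) hq (hε.trans_le hp) rfl
  rw [div_pow, le_div_iff₀ (by positivity)]
  calc (1 - ε) ^ (1 + s) * ((2 : ℝ) ^ (R * s)) ^ n ≤ (1 - ε) ^ (1 + s) * (K : ℝ) ^ s :=
        mul_le_mul_of_nonneg_left hKs (by positivity)
    _ = (1 - ε) * ((1 - ε) / (1 / (K : ℝ))) ^ s := by
        rw [div_div_eq_mul_div, div_one, Real.mul_rpow hε.le hK0.le, Real.rpow_add hε,
          Real.rpow_one, mul_assoc]
    _ ≤ (T * ρ₀).trace.re * ((T * ρ₀).trace.re / (1 / (K : ℝ))) ^ s := by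
        have := hε.le.trans hp
        have hs0 := hs.1.le
        gcongr
    _ ≤ Q ^ n := hm

/-- The separable state and `s` are chosen from `R` alone, so the exponent does not depend on `n`.
-/
lemma exists_exponent {N : Op A' →ₗ[ℂ] Op B} {ω : Op (A × B)}
    (hsim : TeleportationSimulable N ω) {R : ℝ} (hR : relEntEntanglement ω < (R : EReal)) :
    ∃ c : ℝ, 0 < c ∧ ∀ (n : ℕ) (ε : ℝ), 1 ≤ n → Achievable N n R ε →
      1 - ε ≤ (2 : ℝ) ^ (-(c * n)) := by
  obtain ⟨σ, hσR⟩ := iInf_lt_iff.mp hR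
  obtain ⟨hσ, hσR⟩ := iInf_lt_iff.mp hσR
  obtain ⟨hsep, hσ1⟩ := isSep_of_mem_separableStates hσ
  obtain ⟨s, hs, Q, hQ, hQR⟩ := exists_isPetzQuantity_lt hsim.1 hsep.posSemidef hσR
  have h2 : (0 : ℝ) < 2 ^ (R * s) := by positivity
  have hQ0 : 0 ≤ Q := by
    obtain ⟨U, V, l, m, -, -, -, -, hl, hm, -, -, -, rfl⟩ := hQ
    exact Finset.sum_nonneg fun i _ => Finset.sum_nonneg fun j _ =>
      mul_nonneg (mul_nonneg (Complex.normSq_nonneg _) (hl i))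
        (Real.rpow_nonneg (div_nonneg (hl i) (hm j)) _)
  -- The maximum keeps the base positive, so that its logarithm is genuine and strictly negative.
  set x := max (Q / 2 ^ (R * s)) (1 / 2)
  have hx0 : 0 < x := lt_max_of_lt_right (by norm_num)
  have hx1 : x < 1 := max_lt ((div_lt_one h2).mpr hQR) (by norm_num)
  have hs1 : 0 < 1 + s := by linarith [hs.1]
  refine ⟨-Real.logb 2 x / (1 + s),
    div_pos (neg_pos.mpr (Real.logb_neg one_lt_two hx0 hx1)) hs1, fun n ε hn h => ?_⟩
  rcases le_or_gt (1 - ε) 0 with hε | hε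
  · exact hε.trans (by positivity)
  rw [← Real.rpow_le_rpow_iff hε.le (by positivity) hs1]
  refine (rpow_mul_le_of_achievable hsim hsep hσ1 hs hQ hn h hε).trans ?_
  refine (pow_le_pow_left₀ (by positivity) (le_max_left _ (1 / 2)) n).trans_eq ?_
  have e : -(-Real.logb 2 x / (1 + s) * n) * (1 + s) = Real.logb 2 x * n := by
    field_simp
  rw [← Real.rpow_mul zero_le_two, e, Real.rpow_mul zero_le_two (Real.logb 2 x),
    Real.rpow_logb two_pos (by norm_num) hx0, Real.rpow_natCast]

omit [DecidableEq A'] [DecidableEq B] in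
lemma Achievable.mono {N : Op A' →ₗ[ℂ] Op B} {n : ℕ} {P R ε : ℝ} (h : Achievable N n P ε)
    (hR : R ≤ P) : Achievable N n R ε := by
  obtain ⟨h0, h1, K, sA, sB, ρ, γ, hK, hP, hrest⟩ := h
  exact ⟨h0, h1, K, sA, sB, ρ, γ, hK, hR.trans hP, hrest⟩

lemma isStrongConverseRate_relEntEntanglement {N : Op A' →ₗ[ℂ] Op B} {ω : Op (A × B)}
    (hsim : TeleportationSimulable N ω) : IsStrongConverseRate N (relEntEntanglement ω) := by
  intro P ε hach hlim
  -- A fixed rate strictly between: eventually `P n > R`, so the exponential bound at rate `R`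
  -- applies.
  obtain ⟨R, hR, hRP⟩ := EReal.lt_iff_exists_real_btwn.mp hlim
  obtain ⟨c, hc, hbound⟩ := exists_exponent hsim hR
  have hev : ∀ᶠ n : ℕ in atTop, 1 - (2 : ℝ) ^ (-(c * n)) ≤ ε n := by
    filter_upwards [eventually_lt_of_lt_liminf hRP, eventually_ge_atTop 1] with n hn hn1
    have := hbound n (ε n) hn1 ((hach n hn1).mono (EReal.coe_lt_coe_iff.mp hn).le)
    linarith
  have hev1 : ∀ᶠ n : ℕ in atTop, ε n ≤ 1 := by
    filter_upwards [eventually_ge_atTop 1] with n hn using (hach n hn).2.1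
  have hto : Tendsto (fun n : ℕ => 1 - (2 : ℝ) ^ (-(c * n))) atTop (𝓝 1) := by
    have h1 : Tendsto (fun n : ℕ => ((2 : ℝ) ^ (-c)) ^ n) atTop (𝓝 0) :=
      tendsto_pow_atTop_nhds_zero_of_lt_one (by positivity)
        (Real.rpow_lt_one_of_one_lt_of_neg one_lt_two (neg_neg_of_pos hc))
    have h2 : (fun n : ℕ => 1 - (2 : ℝ) ^ (-(c * n))) = fun n : ℕ => 1 - ((2 : ℝ) ^ (-c)) ^ n := by
      ext n
      rw [← Real.rpow_natCast, ← Real.rpow_mul zero_le_two, neg_mul]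
    rw [h2]
    simpa using h1.const_sub 1
  exact tendsto_of_tendsto_of_tendsto_of_le_of_le' hto tendsto_const_nhds hev hev1

end

end QPriv

theorem mainTheorem3 {A A' B : Type} [Fintype A] [Fintype A'] [Fintype B]
    [DecidableEq A] [DecidableEq A'] [DecidableEq B]
    (N : Op A' →ₗ[ℂ] Op B) (hN : IsChannel N)
    (ω : Op (A × B)) (hsim : TeleportationSimulable N ω) :
    IsStrongConverseRate N (relEntEntanglement ω) ∧
    strongConversePrivateCapacity N ≤ relEntEntanglement ω ∧
    ∀ R : ℝ, relEntEntanglement ω < (R : EReal) →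
      ∃ c : ℝ, 0 < c ∧ ∀ (n : ℕ) (ε : ℝ), 1 ≤ n → Achievable N n R ε →
        1 - ε ≤ (2 : ℝ) ^ (-(c * n)) :=
  ⟨isStrongConverseRate_relEntEntanglement hsim,
    sInf_le (isStrongConverseRate_relEntEntanglement hsim),
    fun _ hR => exists_exponent hsim hR⟩
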